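/- Let $\mathbb F_q$ be a finite field of characteristic different from $2$, and let $n\ge 1$ be an integer. All geometric objects (intersection points, tangent lines, torsion points) are taken over $\overline{\mathbb F}_q$. An ordered pair $(\mathcal A,\mathcal B)$ of smooth plane conics over $\mathbb F_q$ meeting transversally (in four distinct points) satisfies the Poncelet $n$-gon condition if $j^n(P,\xi)=(P,\xi)$ for some $(P,\xi)$ in the curve of pairs consisting of a point $P\in\mathcal A$ and a tangent line $\xi$ of $\mathcal B$ with $P\in\xi$; here $j(P,\xi)=(P',\xi')$, where $P'$ is the second point of $\xi\cap\mathcal A$ (equal to $P$ if $\xi$ is tangent to $\mathcal A$) and $\xi'$ is the second tangent line to $\mathcal B$ through $P'$ (equal to $\xi$ if there is only one). Let $\mathcal P$ be a pencil of conics over $\mathbb F_q$ (all $\mathbb F_q$-combinations $\eta_1F+\eta_2G$, $(\eta_1:\eta_2)\in\mathbb P^1(\mathbb F_q)$, of two distinct conics $F,G$) whose base locus consists of four distinct points. Its intersection type is the cycle type of the $q$-power Frobenius on these four points. Let $n^{\mathcal P}$ be the number of ordered pairs of smooth members of $\mathcal P$, meeting transversally, that satisfy the Poncelet $n$-gon condition.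 For an elliptic curve $E:y^2=f(x)$, $f$ a monic cubic, put $$N_n(E)=\bigl|\{P\in E[n]\setminus E[2] : x(P)\in\mathbb F_q\}\bigr|,\qquad E[n]\subset E(\overline{\mathbb F}_q).$$ 1. If $\mathcal P$ has type $(1,1,1,1)$ or $(2,2)$, then $$n^{\mathcal P}=\frac12\sum_{\lambda_0\in\mathbb F_q\setminus\{0,1\}}N_n\bigl(y^2=x(x-1)(x-\lambda_0)\bigr).$$ 2. If $\mathcal P$ has type $(2,1,1)$ or $(4)$, then for every non-square $b\in\mathbb F_q$ $$n^{\mathcal P}=\frac12\sum_{\lambda_0\in\mathbb F_q}N_n\bigl(y^2=(x-\lambda_0)(x^2-b)\bigr).$$ 3. If $\mathcal P$ has type $(3,1)$, then for every $\alpha\in\mathbb F_{q^3}\setminus\mathbb F_q$, with conjugates $\alpha_i=\alpha^{q^i}$, $i=0,1,2$, $$n^{\mathcal P}=\frac12\sum_{\lambda_0\in\mathbb P^1(\mathbb F_q)}N_n(E_{\lambda_0}),$$ where $E_{\lambda_0}:y^2=\prod_{i=0}^{2}\Bigl(x-\frac{\alpha_i}{\alpha_i+\lambda_0}\Bigr)$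 for $\lambda_0\in\mathbb F_q\setminus\{0\}$, $E_0:y^2=\prod_{i=0}^{2}(x-\alpha_i^{-1})$ and $E_\infty:y^2=\prod_{i=0}^{2}(x-\alpha_i)$. -/

import Mathlib

open scoped LinearAlgebra.Projectivization

noncomputable section

namespace Poncelet

universe u v

/-- The symmetric `3 × 3` matrices over `F`. -/
def symMatrices (F : Type u) [Field F] : Submodule F (Matrix (Fin 3) (Fin 3) F) where
  carrier := {M | M.IsSymm}
  add_mem' h₁ h₂ := h₁.add h₂
  zero_mem' := Matrix.isSymm_zero
  smul_mem' c _ h := h.smul c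

/-- A projective plane conic over a field `F` of characteristic different from `2`:
a nonzero symmetric matrix `M` up to scaling, standing for the equation `vᵀ M v = 0`. -/
abbrev Conic (F : Type u) [Field F] := ℙ F (symMatrices F)

/-- The projective plane over `K`. -/
abbrev Plane (K : Type v) [Field K] := ℙ K (Fin 3 → K)

/-- The lines of the projective plane over `K`, given by their coefficient vectors:
`ξ` stands for the line `{X | ξ₀ X₀ + ξ₁ X₁ + ξ₂ X₂ = 0}`. -/
abbrev DualPlane (K : Type v) [Field K] := ℙ K (Fin 3 → K)

/-- Incidence of a point and a line. -/
def OnLine {K : Type v} [Field K] (X : Plane K) (ξ : DualPlane K) : Prop :=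
  ξ.rep ⬝ᵥ X.rep = 0

section Conics

variable {F : Type u} [Field F] (K : Type v) [Field K] [Algebra F K]

/-- A matrix representing the conic `C`, with its entries read in the extension field `K`. -/
def Conic.mat (C : Conic F) : Matrix (Fin 3) (Fin 3) K :=
  (C.rep : Matrix (Fin 3) (Fin 3) F).map (algebraMap F K)

/-- The `K`-points of the conic `C`. -/
def Conic.points (C : Conic F) : Set (Plane K) :=
  {X | X.rep ⬝ᵥ (C.mat K).mulVec X.rep = 0}

/-- The conic `C` has no singular `K`-point; the gradient of `vᵀ M v` is `2 M v`.
Used with `K` an algebraic closure of `F`. -/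
def Conic.IsSmooth (C : Conic F) : Prop :=
  ∀ X ∈ C.points K, (C.mat K).mulVec X.rep ≠ 0

/-- The dual conic of a (smooth) conic `C`, that is, the set of its tangent lines.
The tangent line at the point `v` has coefficient vector `M v`. -/
def Conic.tangents (C : Conic F) : Set (DualPlane K) :=
  {ξ | ∃ X ∈ C.points K, ∃ c : K, ξ.rep = c • (C.mat K).mulVec X.rep}

/-- Two conics intersect transversally: they meet in four distinct points.
Used with `K` an algebraic closure of `F`. -/
def Transversal (A B : Conic F) : Prop :=
  (A.points K ∩ B.points K).ncard = 4

/-- The incidence curve `E ⊆ A × B*` of pairs `(P, ξ)` of a point `P` of `A` and a line `ξ` tangent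
to `B` with `P ∈ ξ`. -/
def incidenceCurve (A B : Conic F) : Set (Plane K × DualPlane K) :=
  {e | e.1 ∈ A.points K ∧ e.2 ∈ B.tangents K ∧ OnLine e.1 e.2}

/-- The graph of the Poncelet map `j : (P, ξ) ↦ (P', ξ')`: the points of `A` on `ξ` are `P` and `P'`
(with `P' = P` if there is only one), and the tangents of `B` through `P'` are `ξ` and `ξ'`
(with `ξ' = ξ` if there is only one). -/
def PonceletStep (A B : Conic F) (e e' : Plane K × DualPlane K) : Prop :=
  {X | X ∈ A.points K ∧ OnLine X e.2} = {e.1, e'.1} ∧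
  {ξ | ξ ∈ B.tangents K ∧ OnLine e'.1 ξ} = {e.2, e'.2}

/-- `(A, B)` satisfies the Poncelet `n`-gon condition: `j^n (P, ξ) = (P, ξ)` for some `(P, ξ) ∈ E`.
Used with `K` an algebraic closure of `F`. -/
def PonceletCondition (n : ℕ) (A B : Conic F) : Prop :=
  ∃ s : ℕ → Plane K × DualPlane K, s 0 ∈ incidenceCurve K A B ∧
    (∀ i, PonceletStep K A B (s i) (s (i + 1))) ∧ s n = s 0

end Conics

/-- A pencil of conics over `F`: a two-dimensional space of symmetric matrices, whose members are
the conics `η₁ M₁ + η₂ M₂ = 0` spanned by two distinct conics `M₁`, `M₂`. -/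
structure Pencil (F : Type u) [Field F] where
  space : Submodule F (symMatrices F)
  finrank_eq : Module.finrank F space = 2

/-- The conics (over `F`) that belong to a pencil. -/
def Pencil.members {F : Type u} [Field F] (P : Pencil F) : Set (Conic F) :=
  {C | C.rep ∈ P.space}

/-- The `K`-points common to all conics of a pencil. -/
def Pencil.basePoints {F : Type u} [Field F] (K : Type v) [Field K] [Algebra F K]
    (P : Pencil F) : Set (Plane K) :=
  {X | ∀ C ∈ P.members, X ∈ C.points K}

/-- The action of the `q`-power Frobenius on the projective plane, `q = |F|`. -/
def frobPoint (F : Type u) [Fintype F] {K : Type v} [Field K] (X : Plane K) : Plane K :=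
  Projectivization.mk K (fun i => X.rep i ^ Fintype.card F) (by
    intro h
    apply X.rep_nonzero
    funext i
    exact eq_zero_of_pow_eq_zero (congrFun h i))

/-- The pencil has intersection type `μ` (a partition of `4`): its base locus over `K`
consists of four distinct points, and the `q`-power Frobenius permutes them with cycle
lengths `μ` (fixed points counted as cycles of length `1`).
Used with `K` an algebraic closure of `F`. -/
def Pencil.HasType {F : Type u} [Field F] [Fintype F] (K : Type v) [Field K] [Algebra F K]
    (P : Pencil F) (μ : Multiset ℕ) : Prop :=
  ∃ (p : Fin 4 → Plane K) (σ : Equiv.Perm (Fin 4)),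
    Function.Injective p ∧ P.basePoints K = Set.range p ∧
    (∀ i, frobPoint F (p i) = p (σ i)) ∧ σ.partition.parts = μ

/-- The ordered pairs of smooth conics of the pencil that intersect transversally and satisfy the
Poncelet `n`-gon condition. -/
def Pencil.ponceletPairs {F : Type u} [Field F] (K : Type v) [Field K] [Algebra F K]
    (P : Pencil F) (n : ℕ) : Set (Conic F × Conic F) :=
  {c | c.1 ∈ P.members ∧ c.2 ∈ P.members ∧ c.1.IsSmooth K ∧ c.2.IsSmooth K ∧
    Transversal K c.1 c.2 ∧ PonceletCondition K n c.1 c.2}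

/-- The Weierstrass curve `y² = f(x)`, for a monic cubic polynomial `f`. -/
def cubicCurve {K : Type v} [Field K] (f : Polynomial K) : WeierstrassCurve K where
  a₁ := 0
  a₂ := f.coeff 2
  a₃ := 0
  a₄ := f.coeff 1
  a₆ := f.coeff 0

/-- For `y² = f(x)` over `K`, the set of points `P ∈ E[n] ∖ E[2]` over `K` with `x(P) ∈ F`. -/
def torsionPoints (F : Type u) [Field F] {K : Type v} [Field K] [DecidableEq K] [Algebra F K]
    (n : ℕ) (f : Polynomial K) : Set (cubicCurve f).toAffine.Point :=
  {P | n • P = 0 ∧ 2 • P ≠ 0 ∧ ∃ (x : F) (y : K)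
    (h : (cubicCurve f).toAffine.Nonsingular (algebraMap F K x) y), P = .some _ y h}

/-- The number of points `P ∈ E[n] ∖ E[2]` over `K` with `x(P) ∈ F`, for `E : y² = f(x)`. -/
def torsionCount (F : Type u) [Field F] {K : Type v} [Field K] [DecidableEq K] [Algebra F K]
    (n : ℕ) (f : Polynomial K) : ℕ :=
  (torsionPoints F n f).ncard

end Poncelet

end

/-!
The projection of the curve of pairs `(P, ξ)` to `A ≅ ℙ¹` is a double cover branched at the four
base points of the pencil of `A` and `B`, so the curve has genus one. If the members of the pencil
are parametrized by `ℙ¹` with `A` at `∞`, it is isomorphic to `y² = f(x)`, where the roots of `f`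
are the parameters of the three degenerate members, and `j` becomes the translation by a point whose
`x`-coordinate is the parameter of `B`. So `(A, B)` is a Poncelet pair if and only if this point is
killed by `n`, and it is not killed by `2` because `B` is smooth and different from `A`. The point
and its negative have the same `x`-coordinate, which accounts for the factor `1 / 2`.

It remains to let `A` vary. The pencil is a projective line over `F` on which Frobenius permutes the
three degenerate members as it permutes the three splittings of the base points into two pairs.
According to the type this is the identity, a transposition or a 3-cycle, and two such triples with
the same permutation are related by a projectivity over `F`. So the degenerate members may be put at
`0, 1, ∞`, at `∞, ± √b` or at the conjugates of `α`.
-/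

noncomputable section

namespace Poncelet

section GroupLaw

open WeierstrassCurve.Affine

variable {K : Type*} [Field K]

/-- The `x`-coordinate of a point of an affine Weierstrass curve, with `none` for infinity. -/
def xCoord {W : WeierstrassCurve.Affine K} : W.Point → Option K
  | .zero => none
  | .some x _ _ => some x

/-- The symmetric biquadratic form in `s` and `t` that vanishes if and only if `s`, `t` and `c` are
the `x`-coordinates of three collinear points of `y² = f(x)`. Each of `s` and `t` lives on the
projective line, with `none` for infinity, and is dehomogenized separately. -/
def collinearityForm (f : Polynomial K) (c : K) : Option K → Option K → K
  | none, none => 1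
  | none, some t => (t - c) ^ 2
  | some s, none => (s - c) ^ 2
  | some s, some t => (f.coeff 1 - (s * t + s * c + t * c)) ^ 2 -
      4 * (s + t + c + f.coeff 2) * (s * t * c + f.coeff 0)

/-- The value at `x` of the monic cubic with the coefficients of `f` in degrees `< 3`, the right
hand side of the equation of `cubicCurve f`. -/
def cubicEval (f : Polynomial K) (x : K) : K :=
  x ^ 3 + f.coeff 2 * x ^ 2 + f.coeff 1 * x + f.coeff 0

variable {f : Polynomial K}

lemma equation_cubicCurve {x y : K} :
    (cubicCurve f).toAffine.Equation x y ↔ y ^ 2 = cubicEval f x := by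
  simp [equation_iff, cubicCurve, cubicEval]

lemma nonsingular_cubicCurve_of_ne_zero (h2 : (2 : K) ≠ 0) {x y : K}
    (h : y ^ 2 = cubicEval f x) (hy : y ≠ 0) : (cubicCurve f).toAffine.Nonsingular x y := by
  refine (nonsingular_iff x y).2 ⟨equation_cubicCurve.2 h, Or.inr fun hneg => ?_⟩
  have : 2 * y = 0 := by
    simp only [cubicCurve] at hneg
    linear_combination hneg
  exact mul_ne_zero h2 hy this

lemma negY_cubicCurve (f : Polynomial K) (x y : K) : (cubicCurve f).toAffine.negY x y = -y := by
  simp [negY, cubicCurve]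

lemma xCoord_neg (R : (cubicCurve f).toAffine.Point) : xCoord (-R) = xCoord R := by
  cases R <;> rfl

lemma eq_zero_of_xCoord_eq_none {R : (cubicCurve f).toAffine.Point} (hR : xCoord R = none) :
    R = 0 := by
  cases R with
  | zero => rfl
  | some => cases hR

lemma eq_or_eq_neg_of_xCoord_eq {R S : (cubicCurve f).toAffine.Point}
    (h : xCoord R = xCoord S) : R = S ∨ R = -S := by
  rcases R with _ | ⟨x, y, hR⟩ <;> rcases S with _ | ⟨x', y', hS⟩ <;> cases h
  · exact Or.inl rfl
  · rcases sq_eq_sq_iff_eq_or_eq_neg.1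
      ((equation_cubicCurve.1 hR.1).trans (equation_cubicCurve.1 hS.1).symm) with rfl | rfl
    · exact Or.inl rfl
    · right
      simp only [Point.neg_some, negY_cubicCurve]

variable [DecidableEq K]

lemma two_nsmul_eq_zero_iff (h2 : (2 : K) ≠ 0) {c : K} {Q : (cubicCurve f).toAffine.Point}
    (hQ : xCoord Q = some c) : 2 • Q = 0 ↔ cubicEval f c = 0 := by
  rcases Q with _ | ⟨x, d, h⟩ <;> cases hQ
  rw [two_nsmul, add_eq_zero_iff_eq_neg, Point.neg_some, Point.some.injEq, negY_cubicCurve,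
    ← equation_cubicCurve.1 h.1, pow_eq_zero_iff two_ne_zero]
  refine ⟨fun ⟨_, hd⟩ => ?_, fun hd => by simp [hd]⟩
  exact (mul_eq_zero.1 (show 2 * d = 0 by linear_combination hd)).resolve_left h2

lemma xCoord_add_of_ne {x y c d : K}
    (h : (cubicCurve f).toAffine.Nonsingular x y) (h' : (cubicCurve f).toAffine.Nonsingular c d)
    (hx : x ≠ c) :
    xCoord (Point.some x y h + Point.some c d h') =
      some (((y - d) / (x - c)) ^ 2 - f.coeff 2 - x - c) := by
  rw [Point.add_of_X_ne hx]
  simp only [xCoord, addX, slope_of_X_ne hx]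
  simp [cubicCurve]

lemma xCoord_two_nsmul (h2 : (2 : K) ≠ 0) {x y : K}
    (h : (cubicCurve f).toAffine.Nonsingular x y) (hy : y ≠ 0) :
    xCoord (2 • Point.some x y h) =
      some (((3 * x ^ 2 + 2 * f.coeff 2 * x + f.coeff 1) / (2 * y)) ^ 2 - f.coeff 2 - x - x) := by
  have hy' : y ≠ (cubicCurve f).toAffine.negY x y := by
    rw [negY_cubicCurve]
    exact fun hneg => mul_ne_zero h2 hy (by linear_combination hneg)
  rw [two_nsmul, Point.add_self_of_Y_ne hy']
  simp only [xCoord, addX, slope_of_Y_ne rfl hy', negY_cubicCurve]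
  simp only [cubicCurve]
  congr 1
  ring

lemma collinearityForm_eq_mul {x c : K} {R Q : (cubicCurve f).toAffine.Point}
    (hR : xCoord R = some x) (hQ : xCoord Q = some c) (hxc : x ≠ c) :
    ∃ t₁ t₂, xCoord (R + Q) = some t₁ ∧ xCoord (R - Q) = some t₂ ∧
      ∀ t, collinearityForm f c (some x) (some t) = (x - c) ^ 2 * ((t - t₁) * (t - t₂)) := by
  rcases R with _ | ⟨x, y, hxy⟩ <;> cases hR
  rcases Q with _ | ⟨c, d, hcd⟩ <;> cases hQ
  refine ⟨_, _, xCoord_add_of_ne hxy hcd hxc, by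
    rw [sub_eq_add_neg, Point.neg_some, xCoord_add_of_ne hxy _ hxc], fun t => ?_⟩
  have hxc' : x - c ≠ 0 := sub_ne_zero.2 hxc
  have ex := equation_cubicCurve.1 hxy.1
  have ec := equation_cubicCurve.1 hcd.1
  simp only [cubicEval] at ex ec
  have coeff_one : f.coeff 1 =
      (y ^ 2 - d ^ 2 - (x ^ 3 - c ^ 3) - f.coeff 2 * (x ^ 2 - c ^ 2)) / (x - c) := by
    field_simp
    linear_combination ec - ex
  have coeff_zero : f.coeff 0 = y ^ 2 - x ^ 3 - f.coeff 2 * x ^ 2 - f.coeff 1 * x := by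
    linear_combination -ex
  simp only [collinearityForm, negY_cubicCurve]
  rw [coeff_zero, coeff_one]
  field_simp
  ring

lemma collinearityForm_self_eq_mul (h2 : (2 : K) ≠ 0) {c : K}
    {Q : (cubicCurve f).toAffine.Point} (hQ : xCoord Q = some c) (h2Q : 2 • Q ≠ 0) :
    ∃ u, xCoord (2 • Q) = some u ∧
      ∀ t, collinearityForm f c (some c) (some t) = 4 * cubicEval f c * (u - t) := by
  have hc := mt (two_nsmul_eq_zero_iff h2 hQ).2 h2Q
  rcases Q with _ | ⟨c, d, h⟩ <;> cases hQ
  have ec := equation_cubicCurve.1 h.1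
  have hd : d ≠ 0 := fun hd => hc (by rw [← ec, hd, zero_pow two_ne_zero])
  refine ⟨_, xCoord_two_nsmul h2 h hd, fun t => ?_⟩
  rw [div_pow, mul_pow, ec]
  simp only [collinearityForm]
  field_simp
  simp only [cubicEval]
  ring

theorem collinearityForm_eq_zero_iff (h2 : (2 : K) ≠ 0) {c : K}
    {Q : (cubicCurve f).toAffine.Point} (hQ : xCoord Q = some c) (h2Q : 2 • Q ≠ 0)
    (R : (cubicCurve f).toAffine.Point) (t : Option K) :
    collinearityForm f c (xCoord R) t = 0 ↔ t = xCoord (R + Q) ∨ t = xCoord (R - Q) := by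
  rcases hR : xCoord R with _ | x
  · rw [eq_zero_of_xCoord_eq_none hR, zero_add, zero_sub, xCoord_neg, or_self, hQ]
    cases t <;> simp [collinearityForm, sub_eq_zero]
  by_cases hxc : x = c
  · subst hxc
    obtain ⟨u, hu, hform⟩ := collinearityForm_self_eq_mul h2 hQ h2Q
    have doubling : collinearityForm f x (some x) t = 0 ↔ t = xCoord (2 • Q) ∨ t = none := by
      have h4 : 4 * cubicEval f x ≠ 0 := by
        rw [← show (2 : K) * 2 = 4 by norm_num]
        exact mul_ne_zero (mul_ne_zero h2 h2) (mt (two_nsmul_eq_zero_iff h2 hQ).2 h2Q)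
      cases t with
      | none => simp [collinearityForm]
      | some t => simp [hform, hu, h4, sub_eq_zero, eq_comm (a := t)]
    rw [doubling]
    rcases eq_or_eq_neg_of_xCoord_eq (hR.trans hQ.symm) with rfl | rfl
    · rw [two_nsmul, sub_self]
      rfl
    · rw [neg_add_cancel, ← neg_add', ← two_nsmul, xCoord_neg, or_comm]
      rfl
  · obtain ⟨t₁, t₂, h₁, h₂, hform⟩ := collinearityForm_eq_mul hR hQ hxc
    rw [h₁, h₂]
    cases t with
    | none => simp [collinearityForm, sub_ne_zero.2 hxc]
    | some t => simp [hform, sub_ne_zero.2 hxc, sub_eq_zero]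

end GroupLaw

section Plane

open Matrix

variable {F : Type*} [Field F] {K : Type*} [Field K] [Algebra F K]

lemma mk_mem_points {C : Conic F} {v : Fin 3 → K} (hv : v ≠ 0) :
    Projectivization.mk K v hv ∈ C.points K ↔ v ⬝ᵥ C.mat K *ᵥ v = 0 := by
  obtain ⟨a, ha⟩ := Projectivization.exists_smul_eq_mk_rep K v hv
  simp only [Conic.points, Set.mem_ofPred_eq, ← ha, Units.smul_def, mulVec_smul, smul_dotProduct,
    dotProduct_smul, smul_eq_mul, mul_eq_zero, a.ne_zero, false_or]

lemma onLine_mk {v ξ : Fin 3 → K} (hv : v ≠ 0) (hξ : ξ ≠ 0) :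
    OnLine (Projectivization.mk K v hv) (Projectivization.mk K ξ hξ) ↔ ξ ⬝ᵥ v = 0 := by
  obtain ⟨a, ha⟩ := Projectivization.exists_smul_eq_mk_rep K v hv
  obtain ⟨b, hb⟩ := Projectivization.exists_smul_eq_mk_rep K ξ hξ
  simp only [OnLine, ← ha, ← hb, Units.smul_def, smul_dotProduct, dotProduct_smul, smul_eq_mul,
    mul_eq_zero, a.ne_zero, b.ne_zero, false_or]

lemma isSmooth_iff_det_ne_zero {C : Conic F} : C.IsSmooth K ↔ (C.mat K).det ≠ 0 := by
  constructor
  · intro h h0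
    obtain ⟨v, hv, hv0⟩ := Matrix.exists_mulVec_eq_zero_iff.2 h0
    obtain ⟨a, ha⟩ := Projectivization.exists_smul_eq_mk_rep K v hv
    refine h (.mk K v hv) ((mk_mem_points hv).2 (by rw [hv0, dotProduct_zero])) ?_
    rw [← ha, Units.smul_def, mulVec_smul, hv0, smul_zero]
  · intro h X _ h0
    exact h (Matrix.exists_mulVec_eq_zero_iff.1 ⟨_, X.rep_nonzero, h0⟩)

lemma mk_mem_tangents {C : Conic F} (hC : (C.mat K).det ≠ 0) {ξ : Fin 3 → K} (hξ : ξ ≠ 0) :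
    Projectivization.mk K ξ hξ ∈ C.tangents K ↔ ξ ⬝ᵥ (C.mat K)⁻¹ *ᵥ ξ = 0 := by
  have hu : IsUnit (C.mat K).det := isUnit_iff_ne_zero.2 hC
  obtain ⟨b, hb⟩ := Projectivization.exists_smul_eq_mk_rep K ξ hξ
  constructor
  · rintro ⟨X, hX, c, hc⟩
    have hX' : X.rep ⬝ᵥ C.mat K *ᵥ X.rep = 0 := hX
    have e : ξ = ((b⁻¹ : Kˣ) * c : K) • C.mat K *ᵥ X.rep := by
      rw [mul_smul, ← hc, ← hb, Units.smul_def, smul_smul, Units.inv_mul, one_smul]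
    rw [e, mulVec_smul, mulVec_mulVec, nonsing_inv_mul _ hu, one_mulVec, smul_dotProduct,
      dotProduct_smul, dotProduct_comm, hX', smul_zero, smul_zero]
  · intro h
    have e : C.mat K *ᵥ (C.mat K)⁻¹ *ᵥ ξ = ξ := by
      rw [mulVec_mulVec, mul_nonsing_inv _ hu, one_mulVec]
    have hv : (C.mat K)⁻¹ *ᵥ ξ ≠ 0 := by
      intro h0
      rw [h0, mulVec_zero] at e
      exact hξ e.symm
    obtain ⟨a, ha⟩ := Projectivization.exists_smul_eq_mk_rep K _ hv
    refine ⟨.mk K _ hv, (mk_mem_points hv).2 (by rw [e, dotProduct_comm, h]), b * (a⁻¹ : Kˣ), ?_⟩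
    rw [← ha, ← hb, Units.smul_def, Units.smul_def, mulVec_smul, e, smul_smul, mul_assoc,
      Units.inv_mul, mul_one]

end Plane

section VeroneseConic

open Matrix

variable {K : Type*} [Field K]

/-- The parametrization `t ↦ (1 : t : t²)` of the conic `X₁² = X₀ X₂`, with `none` for infinity. -/
def veronese : Option K → Fin 3 → K
  | none => ![0, 0, 1]
  | some t => ![1, t, t ^ 2]

/-- The line through the points with parameters `s` and `t` of the conic `X₁² = X₀ X₂` (its tangent
if `s = t`). -/
def chord : Option K → Option K → Fin 3 → K
  | none, none => ![1, 0, 0]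
  | none, some t => ![t, -1, 0]
  | some s, none => ![s, -1, 0]
  | some s, some t => ![s * t, -(s + t), 1]

/-- The symmetric matrix of the conic `X₁² = X₀ X₂`. -/
def veroneseMat (K : Type*) [Field K] : Matrix (Fin 3) (Fin 3) K :=
  !![0, 0, -1; 0, 2, 0; -1, 0, 0]

/-- The symmetric matrices, for varying `c`, of the conics which meet the conic `X₁² = X₀ X₂` where
its parameter is infinite or a root of `f`, normalized so that the smooth ones are those with
`f(c) ≠ 0`. -/
def pencilMat (f : Polynomial K) (c : K) : Matrix (Fin 3) (Fin 3) K :=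
  !![2 * f.coeff 0, f.coeff 1, -c; f.coeff 1, 2 * (f.coeff 2 + c), 1; -c, 1, 0]

lemma veronese_ne_zero (t : Option K) : veronese t ≠ 0 := by
  intro h
  cases t with
  | none => simpa [veronese] using congrFun h 2
  | some t => simpa [veronese] using congrFun h 0

lemma chord_ne_zero (s t : Option K) : chord s t ≠ 0 := by
  intro h
  rcases s with _ | s <;> rcases t with _ | t
  · simpa [chord] using congrFun h 0
  · simpa [chord] using congrFun h 1
  · simpa [chord] using congrFun h 1
  · simpa [chord] using congrFun h 2

lemma dotProduct_veronese_some (η : Fin 3 → K) (t : K) :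
    η ⬝ᵥ veronese (some t) = η 0 + η 1 * t + η 2 * t ^ 2 := by
  simp [veronese, dotProduct, Fin.sum_univ_three]

lemma dotProduct_veronese_none (η : Fin 3 → K) : η ⬝ᵥ veronese none = η 2 := by
  simp [veronese, dotProduct, Fin.sum_univ_three]

lemma chord_dotProduct_veronese (s t r : Option K) :
    chord s t ⬝ᵥ veronese r = 0 ↔ r = s ∨ r = t := by
  rcases r with _ | r
  · rw [dotProduct_veronese_none]
    rcases s with _ | s <;> rcases t with _ | t <;> simp [chord]
  · rw [dotProduct_veronese_some]
    rcases s with _ | s <;> rcases t with _ | t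
    · simp [chord]
    · simp [chord, ← sub_eq_add_neg, sub_eq_zero, eq_comm]
    · simp [chord, ← sub_eq_add_neg, sub_eq_zero, eq_comm]
    · rw [show chord (some s) (some t) 0 + chord (some s) (some t) 1 * r +
          chord (some s) (some t) 2 * r ^ 2 = (r - s) * (r - t) by simp [chord]; ring,
        mul_eq_zero, sub_eq_zero, sub_eq_zero, Option.some_inj, Option.some_inj]

lemma veroneseMat_quadric (v : Fin 3 → K) :
    v ⬝ᵥ veroneseMat K *ᵥ v = 2 * (v 1 ^ 2 - v 0 * v 2) := by
  simp only [veroneseMat, dotProduct, mulVec, Fin.sum_univ_three, of_apply, cons_val',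
    cons_val_zero, cons_val_one, cons_val]
  ring

lemma veronese_quadric (t : Option K) : veronese t ⬝ᵥ veroneseMat K *ᵥ veronese t = 0 := by
  rw [veroneseMat_quadric]
  cases t <;> simp [veronese]

lemma exists_veronese_of_quadric (h2 : (2 : K) ≠ 0) {v : Fin 3 → K}
    (h : v ⬝ᵥ veroneseMat K *ᵥ v = 0) : ∃ (t : Option K) (a : K), v = a • veronese t := by
  have hv : v 1 ^ 2 = v 0 * v 2 := by
    rw [veroneseMat_quadric, mul_eq_zero, or_iff_right h2] at h
    exact sub_eq_zero.1 h
  by_cases h0 : v 0 = 0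
  · have h1 : v 1 = 0 := by simpa [h0] using hv
    refine ⟨none, v 2, ?_⟩
    ext i
    fin_cases i <;> simp [veronese, h0, h1]
  · refine ⟨some (v 1 / v 0), v 0, ?_⟩
    ext i
    fin_cases i
    · simp [veronese]
    · change v 1 = v 0 * (v 1 / v 0)
      field_simp
    · change v 2 = v 0 * (v 1 / v 0) ^ 2
      field_simp
      linear_combination -hv

lemma exists_chord_of_dotProduct_veronese {η : Fin 3 → K} {s : Option K}
    (h : η ⬝ᵥ veronese s = 0) : ∃ (t : Option K) (a : K), η = a • chord s t := by
  cases s with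
  | none =>
    rw [dotProduct_veronese_none] at h
    by_cases h1 : η 1 = 0
    · exact ⟨none, η 0, by ext i; fin_cases i <;> simp [chord, h1, h]⟩
    · refine ⟨some (-η 0 / η 1), -η 1, ?_⟩
      ext i
      fin_cases i
      · change η 0 = -η 1 * (-η 0 / η 1)
        field_simp
      · simp [chord]
      · simp [chord, h]
  | some s =>
    rw [dotProduct_veronese_some] at h
    by_cases h2 : η 2 = 0
    · have h0 : η 0 = -η 1 * s := by linear_combination h - h2 * s ^ 2
      exact ⟨none, -η 1, by ext i; fin_cases i <;> simp [chord, h0, h2]⟩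
    · refine ⟨some (-η 1 / η 2 - s), η 2, ?_⟩
      ext i
      fin_cases i
      · change η 0 = η 2 * (s * (-η 1 / η 2 - s))
        field_simp
        linear_combination h
      · change η 1 = η 2 * -(s + (-η 1 / η 2 - s))
        field_simp
        ring
      · simp [chord]

lemma det_pencilMat (f : Polynomial K) (c : K) : (pencilMat f c).det = -2 * cubicEval f c := by
  simp only [pencilMat, det_fin_three, cubicEval, of_apply, cons_val', cons_val_zero,
    cons_val_one, cons_val]
  ring

/-- This links the tangents of the members of the pencil to the group law of `y² = f(x)`. -/
lemma chord_adjugate_pencilMat (f : Polynomial K) (c : K) (s t : Option K) :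
    chord s t ⬝ᵥ (pencilMat f c).adjugate *ᵥ chord s t = -collinearityForm f c s t := by
  rw [adjugate_fin_three]
  rcases s with _ | s <;> rcases t with _ | t <;>
    simp only [chord, pencilMat, collinearityForm, dotProduct, mulVec, Fin.sum_univ_three, of_apply,
      cons_val', cons_val_zero, cons_val_one, cons_val] <;> ring

end VeroneseConic

section StandardCoordinates

open Matrix

variable {F : Type*} [Field F] {K : Type*} [Field K] [Algebra F K]

lemma mulVec_ne_zero_of_det_ne_zero {ι : Type*} [Fintype ι] [DecidableEq ι] {W : Matrix ι ι K}
    (hW : W.det ≠ 0) {v : ι → K} (hv : v ≠ 0) : W *ᵥ v ≠ 0 :=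
  fun h => hW (exists_mulVec_eq_zero_iff.1 ⟨v, hv, h⟩)

lemma mulVec_dotProduct_mulVec_mulVec {ι : Type*} [Fintype ι] (W M : Matrix ι ι K) (v w : ι → K) :
    W *ᵥ v ⬝ᵥ M *ᵥ W *ᵥ w = v ⬝ᵥ (Wᵀ * M * W) *ᵥ w := by
  rw [← mulVec_mulVec, ← mulVec_mulVec, dotProduct_mulVec v, vecMul_transpose]

lemma det_inv_transpose_ne_zero {ι : Type*} [Fintype ι] [DecidableEq ι] {W : Matrix ι ι K}
    (hW : W.det ≠ 0) : W⁻¹ᵀ.det ≠ 0 := by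
  rw [det_transpose, det_nonsing_inv, Ring.inverse_eq_inv']
  exact inv_ne_zero hW

lemma chord_comm (s t : Option K) : chord s t = chord t s := by
  rcases s with _ | s <;> rcases t with _ | t <;> simp [chord, mul_comm, add_comm]

/-- Coordinates `W` in which the pair of conics `A`, `B` takes the standard form `X₁² = X₀ X₂`,
`pencilMat f c`. -/
structure IsStandard (A B : Conic F) (W : Matrix (Fin 3) (Fin 3) K) (f : Polynomial K) (c : K) :
    Prop where
  det_ne_zero : W.det ≠ 0
  fst : ∃ a : K, a ≠ 0 ∧ Wᵀ * A.mat K * W = a • veroneseMat K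
  snd : ∃ b : K, b ≠ 0 ∧ Wᵀ * B.mat K * W = b • pencilMat f c

variable {A B : Conic F} {W : Matrix (Fin 3) (Fin 3) K} {f : Polynomial K} {c : K}

lemma PonceletStep.unique {e e₁ e₂ : Plane K × DualPlane K}
    (h₁ : PonceletStep K A B e e₁) (h₂ : PonceletStep K A B e e₂) : e₁ = e₂ := by
  have pair_right_injective {α : Type _} {a b b' : α} (h : ({a, b} : Set α) = {a, b'}) :
      b = b' := by
    have hb : b = a ∨ b = b' := (Set.ext_iff.1 h b).1 (Or.inr rfl)
    have hb' : b' = a ∨ b' = b := (Set.ext_iff.1 h b').2 (Or.inr rfl)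
    grind
  have hpoint : e₁.1 = e₂.1 := pair_right_injective (h₁.1.symm.trans h₂.1)
  refine Prod.ext hpoint (pair_right_injective (a := e.2) ?_)
  rw [← h₁.2, ← h₂.2, hpoint]

namespace IsStandard

/-- The point of the first conic with parameter `t`. -/
def point (h : IsStandard A B W f c) (t : Option K) : Plane K :=
  .mk K (W *ᵥ veronese t) (mulVec_ne_zero_of_det_ne_zero h.det_ne_zero (veronese_ne_zero t))

/-- The line through the points of the first conic with parameters `s` and `t`. -/
def line (h : IsStandard A B W f c) (s t : Option K) : DualPlane K :=
  .mk K (W⁻¹ᵀ *ᵥ chord s t)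
    (mulVec_ne_zero_of_det_ne_zero (det_inv_transpose_ne_zero h.det_ne_zero) (chord_ne_zero s t))

lemma isUnit_det (h : IsStandard A B W f c) : IsUnit W.det :=
  isUnit_iff_ne_zero.2 h.det_ne_zero

lemma line_comm (h : IsStandard A B W f c) (s t : Option K) : h.line s t = h.line t s := by
  simp only [line, chord_comm s t]

lemma onLine_point_line (h : IsStandard A B W f c) (r s t : Option K) :
    OnLine (h.point r) (h.line s t) ↔ r = s ∨ r = t := by
  rw [point, line, onLine_mk, mulVec_transpose, ← dotProduct_mulVec, mulVec_mulVec,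
    nonsing_inv_mul _ h.isUnit_det, one_mulVec, chord_dotProduct_veronese]

lemma point_mem_points (h : IsStandard A B W f c) (t : Option K) : h.point t ∈ A.points K := by
  obtain ⟨a, -, ha⟩ := h.fst
  rw [point, mk_mem_points, mulVec_dotProduct_mulVec_mulVec, ha, smul_mulVec, dotProduct_smul,
    veronese_quadric, smul_zero]

lemma exists_eq_point (h : IsStandard A B W f c) (h2 : (2 : K) ≠ 0) {X : Plane K}
    (hX : X ∈ A.points K) : ∃ t, X = h.point t := by
  obtain ⟨a, ha0, ha⟩ := h.fst
  have hv : X.rep = W *ᵥ W⁻¹ *ᵥ X.rep := by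
    rw [mulVec_mulVec, mul_nonsing_inv _ h.isUnit_det, one_mulVec]
  have hquadric : (W⁻¹ *ᵥ X.rep) ⬝ᵥ veroneseMat K *ᵥ W⁻¹ *ᵥ X.rep = 0 := by
    have hX' : X.rep ⬝ᵥ A.mat K *ᵥ X.rep = 0 := hX
    rw [hv, mulVec_dotProduct_mulVec_mulVec, ha, smul_mulVec, dotProduct_smul] at hX'
    exact (smul_eq_zero.1 hX').resolve_left ha0
  obtain ⟨t, k, hk⟩ := exists_veronese_of_quadric h2 hquadric
  refine ⟨t, ?_⟩
  rw [point, ← X.mk_rep, Projectivization.mk_eq_mk_iff']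
  exact ⟨k, by rw [hv, hk, mulVec_smul]⟩

lemma exists_eq_line (h : IsStandard A B W f c) {ξ : DualPlane K} {s : Option K}
    (hξ : OnLine (h.point s) ξ) : ∃ t, ξ = h.line s t := by
  rw [← ξ.mk_rep, point, onLine_mk, dotProduct_mulVec, ← mulVec_transpose] at hξ
  obtain ⟨t, k, hk⟩ := exists_chord_of_dotProduct_veronese hξ
  refine ⟨t, ?_⟩
  rw [line, ← ξ.mk_rep, Projectivization.mk_eq_mk_iff']
  refine ⟨k, ?_⟩
  rw [← mulVec_smul, ← hk, mulVec_mulVec, ← transpose_mul, mul_nonsing_inv _ h.isUnit_det,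
    transpose_one, one_mulVec]

lemma point_injective (h : IsStandard A B W f c) : Function.Injective h.point := by
  intro s t hst
  have := (h.onLine_point_line t s s).1 (by rw [← hst, h.onLine_point_line]; exact Or.inl rfl)
  exact (or_self_iff.1 this).symm

lemma line_right_injective (h : IsStandard A B W f c) (s : Option K) :
    Function.Injective (h.line s) := by
  intro t t' he
  have h₁ := h.onLine_point_line t s t'
  have h₂ := h.onLine_point_line t' s t
  rw [← he, h.onLine_point_line] at h₁
  rw [he, h.onLine_point_line] at h₂
  grind

lemma points_on_line (h : IsStandard A B W f c) (h2 : (2 : K) ≠ 0) (s t : Option K) :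
    {X | X ∈ A.points K ∧ OnLine X (h.line s t)} = {h.point s, h.point t} := by
  ext X
  constructor
  · rintro ⟨hX, hl⟩
    obtain ⟨r, rfl⟩ := h.exists_eq_point h2 hX
    rcases (h.onLine_point_line r s t).1 hl with rfl | rfl <;> simp
  · rintro (rfl | rfl)
    · exact ⟨h.point_mem_points _, (h.onLine_point_line _ _ _).2 (Or.inl rfl)⟩
    · exact ⟨h.point_mem_points _, (h.onLine_point_line _ _ _).2 (Or.inr rfl)⟩

lemma line_mem_tangents_iff_collinearityForm (h : IsStandard A B W f c) (h2 : (2 : K) ≠ 0)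
    (hc : cubicEval f c ≠ 0) (s t : Option K) :
    h.line s t ∈ B.tangents K ↔ collinearityForm f c s t = 0 := by
  obtain ⟨b, hb0, hb⟩ := h.snd
  have hd : (pencilMat f c).det ≠ 0 := by
    rw [det_pencilMat]
    exact mul_ne_zero (neg_ne_zero.2 h2) hc
  have hB : (B.mat K).det ≠ 0 := by
    intro h0
    have := congrArg det hb
    rw [det_mul, det_mul, h0, mul_zero, zero_mul, det_smul] at this
    exact mul_ne_zero (pow_ne_zero _ hb0) hd this.symm
  have hinv : W⁻¹ * ((B.mat K)⁻¹ * W⁻¹ᵀ) =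
      (b⁻¹ * (pencilMat f c).det⁻¹) • (pencilMat f c).adjugate := by
    let _ : Invertible b := invertibleOfNonzero hb0
    rw [transpose_nonsing_inv, ← Matrix.mul_inv_rev, ← Matrix.mul_inv_rev, hb,
      Matrix.inv_smul _ b (isUnit_iff_ne_zero.2 hd), invOf_eq_inv, inv_def, Ring.inverse_eq_inv',
      smul_smul]
  rw [line, mk_mem_tangents hB, mulVec_dotProduct_mulVec_mulVec, transpose_transpose,
    Matrix.mul_assoc, hinv, smul_mulVec, dotProduct_smul, chord_adjugate_pencilMat, smul_eq_mul,
    mul_eq_zero, or_iff_right (mul_ne_zero (inv_ne_zero hb0) (inv_ne_zero hd)), neg_eq_zero]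

section Translation

variable [DecidableEq K]

/-- The pair of a point of the first conic and a line that corresponds to the point `R` of
`y² = f(x)`. These pairs lie on the incidence curve if `Q` has `x`-coordinate `c`, and the Poncelet
map is then the translation by `Q`. -/
def toIncidence (h : IsStandard A B W f c) (Q R : (cubicCurve f).toAffine.Point) :
    Plane K × DualPlane K :=
  (h.point (xCoord R), h.line (xCoord R) (xCoord (R + Q)))

variable {Q : (cubicCurve f).toAffine.Point} (h : IsStandard A B W f c) (h2 : (2 : K) ≠ 0)
  (hQ : xCoord Q = some c) (h2Q : 2 • Q ≠ 0)

include h2 hQ h2Q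

lemma line_mem_tangents_iff (R : (cubicCurve f).toAffine.Point) (t : Option K) :
    h.line (xCoord R) t ∈ B.tangents K ↔ t = xCoord (R + Q) ∨ t = xCoord (R - Q) := by
  rw [h.line_mem_tangents_iff_collinearityForm h2 (mt (two_nsmul_eq_zero_iff h2 hQ).2 h2Q),
    collinearityForm_eq_zero_iff h2 hQ h2Q]

lemma tangents_through_point (R : (cubicCurve f).toAffine.Point) :
    {ξ | ξ ∈ B.tangents K ∧ OnLine (h.point (xCoord R)) ξ} =
      {h.line (xCoord R) (xCoord (R - Q)), h.line (xCoord R) (xCoord (R + Q))} := by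
  ext ξ
  constructor
  · rintro ⟨hξ, hl⟩
    obtain ⟨t, rfl⟩ := h.exists_eq_line hl
    rcases (h.line_mem_tangents_iff h2 hQ h2Q R t).1 hξ with rfl | rfl <;> simp
  · have hl (t) := (h.onLine_point_line (xCoord R) (xCoord R) t).2 (Or.inl rfl)
    rintro (rfl | rfl)
    · exact ⟨(h.line_mem_tangents_iff h2 hQ h2Q R _).2 (Or.inr rfl), hl _⟩
    · exact ⟨(h.line_mem_tangents_iff h2 hQ h2Q R _).2 (Or.inl rfl), hl _⟩

lemma toIncidence_mem_incidenceCurve (R : (cubicCurve f).toAffine.Point) :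
    h.toIncidence Q R ∈ incidenceCurve K A B :=
  ⟨h.point_mem_points _, (h.line_mem_tangents_iff h2 hQ h2Q R _).2 (Or.inl rfl),
    (h.onLine_point_line _ _ _).2 (Or.inl rfl)⟩

lemma ponceletStep_toIncidence (R : (cubicCurve f).toAffine.Point) :
    PonceletStep K A B (h.toIncidence Q R) (h.toIncidence Q (R + Q)) := by
  refine ⟨h.points_on_line h2 _ _, ?_⟩
  have := h.tangents_through_point h2 hQ h2Q (R + Q)
  rwa [add_sub_cancel_right, h.line_comm _ (xCoord R)] at this

lemma exists_eq_toIncidence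
    (hf : Function.Surjective (xCoord : (cubicCurve f).toAffine.Point → Option K))
    {e : Plane K × DualPlane K} (he : e ∈ incidenceCurve K A B) : ∃ R, e = h.toIncidence Q R := by
  obtain ⟨X, ξ⟩ := e
  obtain ⟨hX, hξ, hl⟩ := he
  obtain ⟨s, rfl⟩ := h.exists_eq_point h2 hX
  obtain ⟨t, rfl⟩ := h.exists_eq_line hl
  obtain ⟨R, rfl⟩ := hf s
  rcases (h.line_mem_tangents_iff h2 hQ h2Q R t).1 hξ with rfl | rfl
  · exact ⟨R, rfl⟩
  · refine ⟨-R, ?_⟩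
    rw [toIncidence, xCoord_neg, ← xCoord_neg (-R + _), neg_add, neg_neg, ← sub_eq_add_neg]

omit h2 hQ in
lemma toIncidence_injective : Function.Injective (h.toIncidence Q) := by
  intro R S hRS
  rw [toIncidence, toIncidence, Prod.mk.injEq] at hRS
  have hx := h.point_injective hRS.1
  rw [hx] at hRS
  have hx' := h.line_right_injective _ hRS.2
  rcases eq_or_eq_neg_of_xCoord_eq hx with rfl | rfl
  · rfl
  rcases eq_or_eq_neg_of_xCoord_eq hx' with e | e
  · exact add_right_cancel e
  · rw [neg_add, add_right_inj, eq_neg_iff_add_eq_zero, ← two_nsmul] at e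
    exact absurd e h2Q

include h

/-- Poncelet's closure theorem is contained in this: the right hand side does not depend on the
point of the incidence curve where the orbit starts. -/
theorem ponceletCondition_iff
    (hf : Function.Surjective (xCoord : (cubicCurve f).toAffine.Point → Option K)) (n : ℕ) :
    PonceletCondition K n A B ↔ n • Q = 0 := by
  constructor
  · rintro ⟨s, h0, hstep, hn⟩
    obtain ⟨R, hR⟩ := h.exists_eq_toIncidence h2 hQ h2Q hf h0
    have orbit (i : ℕ) : s i = h.toIncidence Q (R + i • Q) := by
      induction i with
      | zero => rw [hR, zero_smul, add_zero]
      | succ i ih =>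
        refine (hstep i).unique ?_
        rw [ih, succ_nsmul, ← add_assoc]
        exact h.ponceletStep_toIncidence h2 hQ h2Q _
    rw [orbit n, hR] at hn
    simpa using h.toIncidence_injective h2Q hn
  · intro hn
    refine ⟨fun i => h.toIncidence Q (i • Q), h.toIncidence_mem_incidenceCurve h2 hQ h2Q _,
      fun i => ?_, by simp only [hn, zero_smul]⟩
    simp only [succ_nsmul]
    exact h.ponceletStep_toIncidence h2 hQ h2Q _

end Translation

end IsStandard

end StandardCoordinates

section BilinearForm

open Matrix

variable {F : Type*} [Field F] (K : Type*) [Field K] [Algebra F K]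

/-- The bilinear form over `K` attached to a symmetric matrix over `F`. -/
def bil : symMatrices F →ₗ[F] LinearMap.BilinForm K (Fin 3 → K) :=
  (Matrix.toBilin'.restrictScalars F).toLinearMap ∘ₗ (Algebra.linearMap F K).mapMatrix ∘ₗ
    (symMatrices F).subtype

variable {K}

lemma bil_apply (M : symMatrices F) (v w : Fin 3 → K) :
    bil K M v w = v ⬝ᵥ (M : Matrix (Fin 3) (Fin 3) F).map (algebraMap F K) *ᵥ w :=
  Matrix.toBilin'_apply' _ _ _

lemma bil_comm (M : symMatrices F) (v w : Fin 3 → K) : bil K M v w = bil K M w v := by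
  have hM : (M : Matrix (Fin 3) (Fin 3) F)ᵀ = M := M.2
  rw [bil_apply, bil_apply, dotProduct_mulVec, ← mulVec_transpose, ← transpose_map, hM,
    dotProduct_comm]

lemma bil_pow_card [Fintype F] (M : symMatrices F) (v w : Fin 3 → K) :
    bil K M v w ^ Fintype.card F =
      bil K M (fun i => v i ^ Fintype.card F) (fun i => w i ^ Fintype.card F) := by
  have h (x : K) : x ^ Fintype.card F = FiniteField.frobeniusAlgHom F K x := rfl
  simp only [h, bil_apply, dotProduct, mulVec, map_sum, map_mul, map_apply, AlgHom.commutes]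

lemma mem_points_iff_bil {C : Conic F} {X : Plane K} :
    X ∈ C.points K ↔ bil K C.rep X.rep X.rep = 0 := by
  rw [bil_apply]
  rfl

lemma mem_points_mk {M : symMatrices F} (hM : M ≠ 0) {X : Plane K} :
    X ∈ Conic.points K (.mk F M hM) ↔ bil K M X.rep X.rep = 0 := by
  obtain ⟨a, ha⟩ := Projectivization.exists_smul_eq_mk_rep F M hM
  simp [mem_points_iff_bil, ← ha, Units.smul_def]

end BilinearForm

section Circuits

variable {K V ι : Type*} [Field K] [AddCommGroup V] [Module K V] [Fintype ι]

/-- A circuit (a minimal linearly dependent family), with its vectors scaled in such a way that its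
linear relations are the multiples of `∑ i, w i = 0`. -/
structure IsCircuit (K : Type*) [Field K] [Module K V] (w : ι → V) : Prop where
  sum_eq_zero : ∑ i, w i = 0
  eq_of_sum_smul_eq_zero : ∀ g : ι → K, ∑ i, g i • w i = 0 → ∀ i j, g i = g j

lemma IsCircuit.ne_zero [Nontrivial ι] {w : ι → V} (hw : IsCircuit K w) (i : ι) : w i ≠ 0 := by
  classical
  intro h0
  obtain ⟨j, hj⟩ := exists_ne i
  have := hw.eq_of_sum_smul_eq_zero (Pi.single i 1) (by simp [Pi.single_apply, h0]) i j
  simp [hj] at this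

lemma IsCircuit.const_smul {w : ι → V} (hw : IsCircuit K w) {c : K} (hc : c ≠ 0) :
    IsCircuit K (c • w) where
  sum_eq_zero := by simp [← Finset.smul_sum, hw.sum_eq_zero]
  eq_of_sum_smul_eq_zero g hg := hw.eq_of_sum_smul_eq_zero g <| by
    simp only [Pi.smul_apply, smul_comm _ c, ← Finset.smul_sum] at hg
    exact (smul_eq_zero.1 hg).resolve_left hc

lemma IsCircuit.comp_perm {w : ι → V} (hw : IsCircuit K w) (π : Equiv.Perm ι) :
    IsCircuit K (w ∘ π) where
  sum_eq_zero := (Equiv.sum_comp π w).trans hw.sum_eq_zero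
  eq_of_sum_smul_eq_zero g hg i j := by
    simpa using hw.eq_of_sum_smul_eq_zero (g ∘ π.symm)
      (by rw [← hg, ← Equiv.sum_comp π]; simp) (π i) (π j)

theorem exists_isCircuit_smul {n : ℕ} {x : Fin (n + 1) → V} (hdep : ¬ LinearIndependent K x)
    (hind : ∀ i : Fin (n + 1), LinearIndependent K (x ∘ i.succAbove)) :
    ∃ g : Fin (n + 1) → K, (∀ i, g i ≠ 0) ∧ IsCircuit K fun i => g i • x i := by
  have eq_zero_of_apply_eq_zero (g : Fin (n + 1) → K) (hg : ∑ i, g i • x i = 0) (i : Fin (n + 1))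
      (hi : g i = 0) (j : Fin (n + 1)) : g j = 0 := by
    rw [Fin.sum_univ_succAbove _ i, hi, zero_smul, zero_add] at hg
    have hsucc := Fintype.linearIndependent_iff.1 (hind i) (g ∘ i.succAbove) hg
    rcases Fin.eq_self_or_eq_succAbove i j with rfl | ⟨k, rfl⟩
    exacts [hi, hsucc k]
  obtain ⟨g, hg, k, hk⟩ := Fintype.not_linearIndependent_iff.1 hdep
  have hg0 (i) : g i ≠ 0 := fun hi => hk (eq_zero_of_apply_eq_zero g hg i hi k)
  refine ⟨g, hg0, hg, fun a ha i j => ?_⟩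
  have h := eq_zero_of_apply_eq_zero (fun m => (a m - a j) * g m) ?_ j (by simp) i
  · exact sub_eq_zero.1 ((mul_eq_zero.1 h).resolve_right (hg0 i))
  · simp only [mul_smul, sub_smul, Finset.sum_sub_distrib, ← Finset.smul_sum, ha, hg, smul_zero,
      sub_zero]

end Circuits

section Frobenius

variable (F : Type*) [Fintype F] {K : Type*} [Field K]

/-- The `q`-power Frobenius, applied to coordinates, permutes the vectors `w i` by `σ`. -/
def FrobPermutes {ι κ : Type*} (w : ι → κ → K) (σ : Equiv.Perm ι) : Prop :=
  ∀ i j, w i j ^ Fintype.card F = w (σ i) j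

variable {F}

lemma FrobPermutes.comp_perm {ι κ : Type*} {w : ι → κ → K} {σ : Equiv.Perm ι}
    (h : FrobPermutes F w σ) (π : Equiv.Perm ι) : FrobPermutes F (w ∘ π) (π⁻¹ * σ * π) :=
  fun i j => by simp [h (π i) j]

/-- Hilbert's theorem 90: since the relation `∑ i, w i = 0` is unique up to scaling, the Frobenius
permutes the `w i` up to one common factor `k`, and a root of `c ^ (q - 1) = k⁻¹` removes it. -/
theorem IsCircuit.exists_frobPermutes_smul [Field F] [Algebra F K] [IsAlgClosed K]
    {ι κ : Type*} [Fintype ι] [Nontrivial ι] {w : ι → κ → K} (hw : IsCircuit K w) {σ : Equiv.Perm ι}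
    (hσ : ∀ i, ∃ k : K, ∀ j, w i j ^ Fintype.card F = k * w (σ i) j) :
    ∃ c : K, c ≠ 0 ∧ FrobPermutes F (c • w) σ := by
  choose k hk using hσ
  have k_eq (i j : ι) : k i = k j := by
    have hsum : ∑ i, k (σ.symm i) • w i = 0 := by
      rw [← Equiv.sum_comp σ]
      ext j
      have := congrArg (FiniteField.frobeniusAlgHom F K) (congrFun hw.sum_eq_zero j)
      simpa [hk] using this
    simpa using hw.eq_of_sum_smul_eq_zero (fun i => k (σ.symm i)) hsum (σ i) (σ j)
  obtain ⟨i₀⟩ := (inferInstance : Nonempty ι)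
  have hk0 : k i₀ ≠ 0 := fun h0 => hw.ne_zero i₀ <| funext fun j =>
    eq_zero_of_pow_eq_zero (by rw [hk, h0, zero_mul])
  have hq : 0 < Fintype.card F - 1 := Nat.sub_pos_of_lt Fintype.one_lt_card
  obtain ⟨c, hc⟩ := IsAlgClosed.exists_pow_nat_eq (k i₀)⁻¹ hq
  refine ⟨c, fun h0 => ?_, fun i j => ?_⟩
  · rw [h0, zero_pow hq.ne'] at hc
    exact inv_ne_zero hk0 hc.symm
  · simp only [Pi.smul_apply, smul_eq_mul]
    rw [mul_pow, hk, k_eq i i₀, show Fintype.card F = Fintype.card F - 1 + 1 by omega, pow_succ, hc]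
    field_simp

end Frobenius

section BasePoints

variable {F : Type*} [Field F] {K : Type*} [Field K] [Algebra F K] {P : Pencil F}

lemma mk_mem_members {M : symMatrices F} (hM : M ≠ 0) :
    (Projectivization.mk F M hM : Conic F) ∈ P.members ↔ M ∈ P.space := by
  obtain ⟨a, ha⟩ := Projectivization.exists_smul_eq_mk_rep F M hM
  change (Projectivization.mk F M hM).rep ∈ P.space ↔ _
  rw [← ha]
  exact Submodule.smul_mem_iff_of_isUnit _ a.isUnit

lemma mem_basePoints_iff_bil {X : Plane K} :
    X ∈ P.basePoints K ↔ ∀ M ∈ P.space, bil K M X.rep X.rep = 0 := by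
  refine ⟨fun h M hM => ?_, fun h C hC => mem_points_iff_bil.2 (h _ hC)⟩
  by_cases h0 : M = 0
  · simp [h0]
  exact (mem_points_mk h0).1 (h _ ((mk_mem_members h0).2 hM))

lemma mk_mem_basePoints {v : Fin 3 → K} (hv : v ≠ 0) :
    Projectivization.mk K v hv ∈ P.basePoints K ↔ ∀ M ∈ P.space, bil K M v v = 0 := by
  obtain ⟨a, ha⟩ := Projectivization.exists_smul_eq_mk_rep K v hv
  simp [mem_basePoints_iff_bil, ← ha, Units.smul_def]

lemma infinite_basePoints_of_line [Infinite K] {x y : Fin 3 → K}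
    (hxy : LinearIndependent K ![x, y])
    (hbil : ∀ M ∈ P.space, bil K M x x = 0 ∧ bil K M x y = 0 ∧ bil K M y y = 0) :
    (P.basePoints K).Infinite := by
  rw [LinearIndependent.pair_iff] at hxy
  have hne (t : K) : x + t • y ≠ 0 := fun h0 =>
    one_ne_zero (hxy 1 t (by rwa [one_smul])).1
  have hinj : Function.Injective fun t : K => Projectivization.mk K _ (hne t) := by
    intro s t hst
    obtain ⟨k, hk⟩ := (Projectivization.mk_eq_mk_iff' K _ _ _ _).1 hst
    obtain ⟨hk1, hkst⟩ := hxy (k - 1) (k * t - s) (by linear_combination (norm := module) hk)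
    rw [sub_eq_zero.1 hk1, one_mul] at hkst
    exact (sub_eq_zero.1 hkst).symm
  refine Set.infinite_of_injective_forall_mem hinj fun t => ?_
  rw [mk_mem_basePoints]
  intro M hM
  obtain ⟨hxx, hxy, hyy⟩ := hbil M hM
  simp [hxx, hxy, hyy, bil_comm M y x]

lemma linearIndependent_rep_of_mem_basePoints [Infinite K] (h2 : (2 : K) ≠ 0)
    {p : Fin 3 → Plane K} (hp : Function.Injective p) (hbase : ∀ i, p i ∈ P.basePoints K)
    (hfin : (P.basePoints K).Finite) : LinearIndependent K fun i => (p i).rep := by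
  by_contra hdep
  have hpair (i : Fin 3) : LinearIndependent K ((fun i => (p i).rep) ∘ i.succAbove) := by
    have hne : p (i.succAbove 0) ≠ p (i.succAbove 1) := by
      simp [hp.eq_iff]
    have hcons : (fun i => (p i).rep) ∘ i.succAbove =
        ![(p (i.succAbove 0)).rep, (p (i.succAbove 1)).rep] := by
      funext j
      fin_cases j <;> rfl
    exact hcons ▸ Projectivization.linearIndependent_pair_iff_ne.2 hne
  obtain ⟨g, hg, hcircuit⟩ := exists_isCircuit_smul hdep hpair
  have hself (M : symMatrices F) (hM : M ∈ P.space) (i : Fin 3) :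
      bil K M (p i).rep (p i).rep = 0 := mem_basePoints_iff_bil.1 (hbase i) M hM
  refine infinite_basePoints_of_line
    (Projectivization.linearIndependent_pair_iff_ne.2 (hp.ne (by decide : (0 : Fin 3) ≠ 1)))
    (fun M hM => ⟨hself M hM 0, ?_, hself M hM 1⟩) hfin
  have hsum : g 0 • (p 0).rep + g 1 • (p 1).rep = -(g 2 • (p 2).rep) := by
    rw [← add_eq_zero_iff_eq_neg, ← hcircuit.sum_eq_zero, Fin.sum_univ_three]
  have hquadric := congrArg (fun v => bil K M v v) hsum
  simp only [map_add, map_smul, map_neg, LinearMap.add_apply, LinearMap.smul_apply,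
    LinearMap.neg_apply, smul_eq_mul, hself M hM, bil_comm M (p 1).rep (p 0).rep] at hquadric
  have hmul : 2 * (g 0 * g 1) * bil K M (p 0).rep (p 1).rep = 0 := by linear_combination hquadric
  exact (mul_eq_zero.1 hmul).resolve_left (mul_ne_zero h2 (mul_ne_zero (hg 0) (hg 1)))

/-- Coordinate vectors of the four base points of a pencil, normalized so as to have sum `0`. -/
structure IsFrame (P : Pencil F) (u : Fin 4 → Fin 3 → K) : Prop where
  isCircuit : IsCircuit K u
  bil_self : ∀ M ∈ P.space, ∀ i, bil K M (u i) (u i) = 0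
  ncard_basePoints : (P.basePoints K).ncard = 4

lemma IsFrame.comp_perm {u : Fin 4 → Fin 3 → K} (h : IsFrame P u) (π : Equiv.Perm (Fin 4)) :
    IsFrame P (u ∘ π) where
  isCircuit := h.isCircuit.comp_perm π
  bil_self M hM _ := h.bil_self M hM _
  ncard_basePoints := h.ncard_basePoints

lemma IsFrame.const_smul {u : Fin 4 → Fin 3 → K} (h : IsFrame P u) {c : K} (hc : c ≠ 0) :
    IsFrame P (c • u) where
  isCircuit := h.isCircuit.const_smul hc
  bil_self M hM i := by simp [h.bil_self M hM i]
  ncard_basePoints := h.ncard_basePoints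

lemma exists_isFrame_smul_rep [Infinite K] (h2 : (2 : K) ≠ 0) {p : Fin 4 → Plane K}
    (hp : Function.Injective p) (hP : P.basePoints K = Set.range p) :
    ∃ g : Fin 4 → K, (∀ i, g i ≠ 0) ∧ IsFrame P fun i => g i • (p i).rep := by
  have hbase (i : Fin 4) : p i ∈ P.basePoints K := hP ▸ Set.mem_range_self i
  have hdep : ¬ LinearIndependent K fun i => (p i).rep := fun h => by
    simpa using h.fintype_card_le_finrank
  obtain ⟨g, hg, hcircuit⟩ := exists_isCircuit_smul hdep fun i =>
    linearIndependent_rep_of_mem_basePoints h2 (hp.comp i.succAbove_right_injective)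
      (fun _ => hbase _) (hP ▸ Set.finite_range p)
  refine ⟨g, hg, hcircuit, fun M hM i => ?_, ?_⟩
  · simp [mem_basePoints_iff_bil.1 (hbase i) M hM]
  · rw [hP, ← Set.image_univ, Set.ncard_image_of_injective _ hp, Set.ncard_univ]
    simp

theorem exists_isFrame_frobPermutes [Fintype F] [IsAlgClosed K] (h2 : (2 : K) ≠ 0)
    {p : Fin 4 → Plane K} {σ : Equiv.Perm (Fin 4)} (hp : Function.Injective p)
    (hP : P.basePoints K = Set.range p) (hσ : ∀ i, frobPoint F (p i) = p (σ i)) :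
    ∃ u : Fin 4 → Fin 3 → K, IsFrame P u ∧ FrobPermutes F u σ := by
  have : Infinite K := IsAlgClosed.instInfinite
  obtain ⟨g, hg, hframe⟩ := exists_isFrame_smul_rep h2 hp hP
  obtain ⟨c, hc, hfrob⟩ := hframe.isCircuit.exists_frobPermutes_smul (F := F) (σ := σ) fun i => by
    have h := hσ i
    rw [frobPoint, ← (p (σ i)).mk_rep, Projectivization.mk_eq_mk_iff'] at h
    obtain ⟨a, ha⟩ := h
    refine ⟨g i ^ Fintype.card F * a * (g (σ i))⁻¹, fun j => ?_⟩
    have haj : a * (p (σ i)).rep j = (p i).rep j ^ Fintype.card F := congrFun ha j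
    simp only [Pi.smul_apply, smul_eq_mul, mul_pow, ← haj]
    field_simp [hg (σ i)]
  exact ⟨_, hframe.const_smul hc, hfrob⟩

end BasePoints

section Splittings

open Matrix

variable {F : Type*} [Field F] {K : Type*} [Field K] [Algebra F K]

/-- The three splittings of four points into two pairs: `splitting a b`, for `a ≠ b`, is the one in
which `a` and `b` form a pair. The splitting `i : Fin 3` is the one which pairs `i` with `3`. -/
def splitting : Fin 4 → Fin 4 → Fin 3 :=
  ![![0, 2, 1, 0], ![2, 0, 0, 1], ![1, 0, 0, 2], ![0, 1, 2, 0]]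

/-- The permutation `σ` of four points acts on their splittings into two pairs by `τ`. -/
def ActsOnSplittings (σ : Equiv.Perm (Fin 4)) (τ : Equiv.Perm (Fin 3)) : Prop :=
  ∀ a b, a ≠ b → splitting (σ a) (σ b) = τ (splitting a b)

/-- The linear form on a pencil with base points `u` which vanishes at the degenerate member that
consists of the two lines of the splitting `i` of the base points. -/
def splitForm (u : Fin 4 → Fin 3 → K) (i : Fin 3) : symMatrices F →ₗ[F] K where
  toFun M := bil K M (u (i + 1).castSucc) (u (i + 2).castSucc)
  map_add' M N := by simp
  map_smul' a M := by simp

/-- The matrix of the first three base points. -/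
def frameMat (u : Fin 4 → Fin 3 → K) : Matrix (Fin 3) (Fin 3) K :=
  Matrix.of fun i j => u j.castSucc i

/-- The matrices of the conics through the coordinate points, which for `∑ i, s i = 0` also pass
through `(1 : 1 : 1)`. -/
def coordinateConicMat (s : Fin 3 → K) : Matrix (Fin 3) (Fin 3) K :=
  !![0, s 2, s 1; s 2, 0, s 0; s 1, s 0, 0]

lemma det_coordinateConicMat (s : Fin 3 → K) :
    (coordinateConicMat s).det = 2 * ∏ i, s i := by
  simp only [coordinateConicMat, det_fin_three, Fin.prod_univ_three, of_apply, cons_val]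
  ring

variable {u : Fin 4 → Fin 3 → K} {P : Pencil F} {M : symMatrices F}

namespace IsFrame

lemma last_eq (h : IsFrame P u) : u 3 = -(u 0 + u 1 + u 2) := by
  rw [eq_neg_iff_add_eq_zero, ← h.isCircuit.sum_eq_zero, Fin.sum_univ_four, add_comm]

lemma sum_splitForm (h : IsFrame P u) (h2 : (2 : K) ≠ 0) (hM : M ∈ P.space) :
    ∑ i, splitForm u i M = 0 := by
  have h3 := h.bil_self M hM 3
  have h_self (i : Fin 4) := h.bil_self M hM i
  have hcomm (i j : Fin 4) := bil_comm M (u i) (u j)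
  rw [h.last_eq] at h3
  simp only [map_neg, map_add, LinearMap.neg_apply, LinearMap.add_apply, h_self] at h3
  have hsum : 2 * (bil K M (u 1) (u 2) + bil K M (u 2) (u 0) + bil K M (u 0) (u 1)) = 0 := by
    linear_combination h3 + hcomm 1 2 + hcomm 2 0 + hcomm 0 1
  exact (Fin.sum_univ_three _).trans ((mul_eq_zero.1 hsum).resolve_left h2)

lemma bil_last (h : IsFrame P u) (h2 : (2 : K) ≠ 0) (hM : M ∈ P.space) (i : Fin 3) :
    bil K M (u 3) (u i.castSucc) = splitForm u i M := by
  have hsum : bil K M (u 1) (u 2) + bil K M (u 2) (u 0) + bil K M (u 0) (u 1) = 0 :=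
    (Fin.sum_univ_three _).symm.trans (h.sum_splitForm h2 hM)
  have h_self (i : Fin 4) := h.bil_self M hM i
  have hcomm (i j : Fin 4) := bil_comm M (u i) (u j)
  have hlast (v : Fin 3 → K) : bil K M (u 3) v =
      -(bil K M (u 0) v + bil K M (u 1) v + bil K M (u 2) v) := by simp [h.last_eq]
  fin_cases i
  · change bil K M (u 3) (u 0) = bil K M (u 1) (u 2)
    linear_combination hlast (u 0) - h_self 0 - hsum + hcomm 0 1
  · change bil K M (u 3) (u 1) = bil K M (u 2) (u 0)
    linear_combination hlast (u 1) - h_self 1 - hsum + hcomm 1 2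
  · change bil K M (u 3) (u 2) = bil K M (u 0) (u 1)
    linear_combination hlast (u 2) - h_self 2 - hsum + hcomm 2 0

lemma bil_eq_splitForm (h : IsFrame P u) (h2 : (2 : K) ≠ 0) (hM : M ∈ P.space) {a b : Fin 4}
    (hab : a ≠ b) : bil K M (u a) (u b) = splitForm u (splitting a b) M := by
  have hlast := h.bil_last h2 hM
  have hlast' (i : Fin 3) : bil K M (u i.castSucc) (u 3) = splitForm u i M :=
    (bil_comm _ _ _).trans (hlast i)
  fin_cases a <;> fin_cases b <;> first
    | exact absurd rfl hab
    | rfl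
    | exact bil_comm _ _ _
    | exact hlast 0
    | exact hlast 1
    | exact hlast 2
    | exact hlast' 0
    | exact hlast' 1
    | exact hlast' 2

lemma splitForm_pow_card [Fintype F] (h : IsFrame P u) (h2 : (2 : K) ≠ 0)
    {σ : Equiv.Perm (Fin 4)} (hσ : FrobPermutes F u σ) {τ : Equiv.Perm (Fin 3)}
    (hτ : ActsOnSplittings σ τ) (hM : M ∈ P.space) (i : Fin 3) :
    splitForm u i M ^ Fintype.card F = splitForm u (τ i) M := by
  obtain ⟨a, b, hab, rfl⟩ : ∃ a b : Fin 4, a ≠ b ∧ splitting a b = i := by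
    revert i
    decide
  rw [← hτ a b hab, ← h.bil_eq_splitForm h2 hM hab,
    ← h.bil_eq_splitForm h2 hM (σ.injective.ne hab), bil_pow_card]
  exact congrArg₂ (bil K M · ·) (funext (hσ a)) (funext (hσ b))

lemma det_frameMat_ne_zero (h : IsFrame P u) : (frameMat u).det ≠ 0 := by
  intro h0
  obtain ⟨g, hg, hg0⟩ := exists_mulVec_eq_zero_iff.2 h0
  refine hg (funext fun j => ?_)
  have hconst := h.isCircuit.eq_of_sum_smul_eq_zero ![g 0, g 1, g 2, 0] ?_ j.castSucc 3
  · fin_cases j <;> exact hconst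
  · ext j
    have hj : u 0 j * g 0 + u 1 j * g 1 + u 2 j * g 2 = 0 := by
      simpa [mulVec, dotProduct, frameMat, Fin.sum_univ_three] using congrFun hg0 j
    simp only [Fin.sum_univ_four, cons_val, zero_smul, Pi.add_apply, Pi.smul_apply, smul_eq_mul,
      Pi.zero_apply]
    linear_combination hj

lemma frameMat_transpose_mul_mul (h : IsFrame P u) (hM : M ∈ P.space) :
    (frameMat u)ᵀ * (M : Matrix (Fin 3) (Fin 3) F).map (algebraMap F K) * frameMat u =
      coordinateConicMat fun i => splitForm u i M := by
  have hgram : (frameMat u)ᵀ * (M : Matrix (Fin 3) (Fin 3) F).map (algebraMap F K) * frameMat u =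
      Matrix.of fun i j : Fin 3 => bil K M (u i.castSucc) (u j.castSucc) := by
    ext i j
    rw [Matrix.mul_assoc, of_apply, bil_apply]
    rfl
  rw [hgram]
  ext i j
  fin_cases i <;> fin_cases j <;> first
    | exact h.bil_self M hM _
    | rfl
    | exact bil_comm _ _ _

lemma det_ne_zero_iff (h : IsFrame P u) (h2 : (2 : K) ≠ 0) (hM : M ∈ P.space) :
    ((M : Matrix (Fin 3) (Fin 3) F).map (algebraMap F K)).det ≠ 0 ↔
      ∀ i, splitForm u i M ≠ 0 := by
  have hdet := congrArg det (h.frameMat_transpose_mul_mul hM)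
  rw [det_mul, det_mul, det_transpose, det_coordinateConicMat] at hdet
  have hne := h.det_frameMat_ne_zero
  calc _ ↔ (frameMat u).det * ((M : Matrix (Fin 3) (Fin 3) F).map (algebraMap F K)).det *
        (frameMat u).det ≠ 0 := by simp [hne]
    _ ↔ _ := by simp [hdet, h2, Finset.prod_eq_zero_iff]

lemma eq_zero_of_splitForm_eq_zero (h : IsFrame P u) (hM : M ∈ P.space)
    (h0 : ∀ i, splitForm u i M = 0) : M = 0 := by
  have hu : IsUnit (frameMat u) :=
    (isUnit_iff_isUnit_det _).2 (isUnit_iff_ne_zero.2 h.det_frameMat_ne_zero)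
  have hzero : coordinateConicMat (fun i => splitForm u i M) = 0 := by
    ext i j
    fin_cases i <;> fin_cases j <;> simp [coordinateConicMat, h0]
  have hmap : (M : Matrix (Fin 3) (Fin 3) F).map (algebraMap F K) = 0 := by
    rwa [← h.frameMat_transpose_mul_mul hM, hu.mul_left_eq_zero,
      ((isUnit_transpose _).2 hu).mul_right_eq_zero] at hzero
  ext i j
  simpa using congrFun (congrFun hmap i) j

end IsFrame

end Splittings

section Cubic

open Polynomial

variable {K : Type*} [Field K]

/-- The monic cubic with the roots `e i`. -/
def cubic (e : Fin 3 → K) : K[X] := ∏ i, (X - C (e i))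

lemma cubic_zero_one (a : K) : cubic ![0, 1, a] = X * (X - 1) * (X - C a) := by
  simp [cubic, Fin.prod_univ_three]

lemma cubic_neg (a b : K) : cubic ![a, b, -b] = (X - C a) * (X ^ 2 - C (b ^ 2)) := by
  simp only [cubic, Fin.prod_univ_three, Matrix.cons_val, map_neg, map_pow]
  ring

lemma cubic_eq_toPoly (e : Fin 3 → K) : cubic e = Cubic.toPoly ⟨1, -(e 0 + e 1 + e 2),
    e 0 * e 1 + e 0 * e 2 + e 1 * e 2, -(e 0 * e 1 * e 2)⟩ := by
  rw [cubic, Fin.prod_univ_three, Cubic.prod_X_sub_C_eq]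

lemma cubic_coeff_zero (e : Fin 3 → K) : (cubic e).coeff 0 = -(e 0 * e 1 * e 2) := by
  rw [cubic_eq_toPoly, Cubic.coeff_eq_d]

lemma cubic_coeff_one (e : Fin 3 → K) :
    (cubic e).coeff 1 = e 0 * e 1 + e 0 * e 2 + e 1 * e 2 := by
  rw [cubic_eq_toPoly, Cubic.coeff_eq_c]

lemma cubic_coeff_two (e : Fin 3 → K) : (cubic e).coeff 2 = -(e 0 + e 1 + e 2) := by
  rw [cubic_eq_toPoly, Cubic.coeff_eq_b]

lemma cubicEval_cubic (e : Fin 3 → K) (x : K) : cubicEval (cubic e) x = ∏ i, (x - e i) := by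
  rw [cubicEval, cubic_coeff_zero, cubic_coeff_one, cubic_coeff_two, Fin.prod_univ_three]
  ring

lemma nonsingular_cubic_root {e : Fin 3 → K} (he : Function.Injective e) (i : Fin 3) :
    (cubicCurve (cubic e)).toAffine.Nonsingular (e i) 0 := by
  have hderiv : 3 * e i ^ 2 + 2 * (cubic e).coeff 2 * e i + (cubic e).coeff 1 =
      (e i - e (i + 1)) * (e i - e (i + 2)) := by
    rw [cubic_coeff_one, cubic_coeff_two]
    fin_cases i <;> simp only [Fin.reduceFinMk, Fin.isValue, Fin.reduceAdd] <;> ring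
  have hne : (e i - e (i + 1)) * (e i - e (i + 2)) ≠ 0 :=
    mul_ne_zero (sub_ne_zero.2 (he.ne (by simp))) (sub_ne_zero.2 (he.ne (by simp)))
  refine (WeierstrassCurve.Affine.nonsingular_iff _ _).2 ⟨equation_cubicCurve.2 ?_, Or.inl ?_⟩
  · rw [cubicEval_cubic, Finset.prod_eq_zero (Finset.mem_univ i) (sub_self _),
      zero_pow two_ne_zero]
  · rw [← hderiv] at hne
    simpa [cubicCurve, eq_comm] using hne

lemma xCoord_surjective_of_cubic [IsAlgClosed K] (h2 : (2 : K) ≠ 0) {e : Fin 3 → K}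
    (he : Function.Injective e) :
    Function.Surjective (xCoord : (cubicCurve (cubic e)).toAffine.Point → Option K)
  | none => ⟨0, rfl⟩
  | some x => by
    by_cases hx : ∃ i, x = e i
    · obtain ⟨i, rfl⟩ := hx
      exact ⟨.some _ _ (nonsingular_cubic_root he i), rfl⟩
    · obtain ⟨y, hy⟩ := IsAlgClosed.exists_pow_nat_eq (cubicEval (cubic e) x) two_pos
      refine ⟨.some x y (nonsingular_cubicCurve_of_ne_zero h2 hy fun hy0 => hx ?_), rfl⟩
      rw [hy0, zero_pow two_ne_zero, cubicEval_cubic, eq_comm, Finset.prod_eq_zero_iff] at hy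
      obtain ⟨i, -, hi⟩ := hy
      exact ⟨i, sub_eq_zero.1 hi⟩

end Cubic

section RootMatrix

open Matrix

variable {K : Type*} [Field K]

/-- The matrix whose `i`-th row consists of the coefficients of the quadratic polynomial with the
two roots `e j`, `j ≠ i`. It takes the points of `X₁² = X₀ X₂` with parameters `e i` to the
coordinate points. -/
def rootMat (e : Fin 3 → K) : Matrix (Fin 3) (Fin 3) K :=
  !![e 1 * e 2, -(e 1 + e 2), 1; e 2 * e 0, -(e 2 + e 0), 1; e 0 * e 1, -(e 0 + e 1), 1]

lemma det_rootMat (e : Fin 3 → K) :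
    (rootMat e).det = (e 0 - e 1) * (e 0 - e 2) * (e 1 - e 2) := by
  simp only [rootMat, det_fin_three, of_apply, cons_val]
  ring

lemma det_rootMat_ne_zero {e : Fin 3 → K} (he : Function.Injective e) : (rootMat e).det ≠ 0 := by
  rw [det_rootMat]
  refine mul_ne_zero (mul_ne_zero ?_ ?_) ?_ <;> exact sub_ne_zero.2 (he.ne (by decide))

lemma rootMat_transpose_mul_veronese (e : Fin 3 → K) :
    (rootMat e)ᵀ * coordinateConicMat (fun i => e (i + 1) - e (i + 2)) * rootMat e =
      (rootMat e).det • veroneseMat K := by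
  rw [det_rootMat, rootMat, coordinateConicMat, veroneseMat]
  ext i j
  fin_cases i <;> fin_cases j <;> simp [mul_apply, Fin.sum_univ_three] <;> ring

lemma rootMat_transpose_mul_pencil (e : Fin 3 → K) (c : K) :
    (rootMat e)ᵀ * coordinateConicMat (fun i => (c - e i) * (e (i + 1) - e (i + 2))) * rootMat e =
      (rootMat e).det • pencilMat (cubic e) c := by
  rw [det_rootMat, rootMat, coordinateConicMat, pencilMat, cubic_coeff_zero, cubic_coeff_one,
    cubic_coeff_two]
  ext i j
  fin_cases i <;> fin_cases j <;> simp [mul_apply, Fin.sum_univ_three] <;> ring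

lemma coordinateConicMat_smul (k : K) (s : Fin 3 → K) :
    coordinateConicMat (k • s) = k • coordinateConicMat s := by
  ext i j
  fin_cases i <;> fin_cases j <;> simp [coordinateConicMat]

lemma exists_eq_smul_sub_of_sum_eq_zero {e s : Fin 3 → K} (he : Function.Injective e)
    (hs : ∑ i, s i = 0) (hes : ∑ i, e i * s i = 0) :
    ∃ k : K, s = k • fun i => e (i + 1) - e (i + 2) := by
  have h12 : e 1 - e 2 ≠ 0 := sub_ne_zero.2 (he.ne (by decide))
  rw [Fin.sum_univ_three] at hs hes
  refine ⟨s 0 / (e 1 - e 2), funext fun i => ?_⟩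
  simp only [Pi.smul_apply, smul_eq_mul]
  rw [div_mul_eq_mul_div, eq_div_iff h12]
  fin_cases i <;> simp only [Fin.reduceFinMk, Fin.isValue, Fin.reduceAdd, Fin.zero_eta, zero_add]
  · linear_combination hes - e 2 * hs
  · linear_combination e 1 * hs - hes

end RootMatrix

section Charts

open Matrix

variable {F : Type*} [Field F] {K : Type*} [Field K] [Algebra F K] {P : Pencil F}
  {u : Fin 4 → Fin 3 → K} {M N : symMatrices F} {e : Fin 3 → K}

lemma exists_mat_mk (hM : M ≠ 0) : ∃ a : K, a ≠ 0 ∧ Conic.mat K (.mk F M hM) =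
    a • (M : Matrix (Fin 3) (Fin 3) F).map (algebraMap F K) := by
  obtain ⟨a, ha⟩ := Projectivization.exists_smul_eq_mk_rep F M hM
  refine ⟨algebraMap F K a, by simp, ?_⟩
  rw [Conic.mat, ← ha]
  ext i j
  simp [Units.smul_def]

/-- A smooth member `M` of the pencil `P` with base points `u`, and a second member `N`, such that
the degenerate members of `P` are the `e i • M - N`. -/
structure IsAffineChart (P : Pencil F) (u : Fin 4 → Fin 3 → K) (M N : symMatrices F)
    (e : Fin 3 → K) : Prop where
  fst_mem : M ∈ P.space
  snd_mem : N ∈ P.space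
  injective : Function.Injective e
  splitForm_fst_ne_zero : ∀ i, splitForm u i M ≠ 0
  splitForm_snd : ∀ i, splitForm u i N = e i * splitForm u i M

namespace IsAffineChart

lemma splitForm_smul_sub (hc : IsAffineChart P u M N e) (c : F) (i : Fin 3) :
    splitForm u i (c • M - N) = (algebraMap F K c - e i) * splitForm u i M := by
  rw [map_sub, map_smul, hc.splitForm_snd, Algebra.smul_def, sub_mul]

lemma smul_sub_mem (hc : IsAffineChart P u M N e) (c : F) : c • M - N ∈ P.space :=
  P.space.sub_mem (P.space.smul_mem c hc.fst_mem) hc.snd_mem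

lemma linearIndependent (hc : IsAffineChart P u M N e) : LinearIndependent F ![M, N] := by
  rw [LinearIndependent.pair_iff]
  intro x y h
  have hroot (i : Fin 3) : algebraMap F K x + algebraMap F K y * e i = 0 := by
    have hi := congrArg (splitForm u i) h
    rw [map_add, map_smul, map_smul, hc.splitForm_snd, map_zero, Algebra.smul_def,
      Algebra.smul_def, ← mul_assoc, ← add_mul] at hi
    exact (mul_eq_zero.1 hi).resolve_right (hc.splitForm_fst_ne_zero i)
  have hne : e 0 - e 1 ≠ 0 := sub_ne_zero.2 (hc.injective.ne (by decide))
  have hy : algebraMap F K y * (e 0 - e 1) = 0 := by linear_combination hroot 0 - hroot 1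
  have hy0 : y = 0 := by simpa [hne] using hy
  exact ⟨by simpa [hy0] using hroot 0, hy0⟩

lemma exists_eq (hc : IsAffineChart P u M N e) {R : symMatrices F} (hR : R ∈ P.space) :
    ∃ x y : F, x • M + y • N = R := by
  have : Module.Finite F P.space := FiniteDimensional.finiteDimensional_submodule _
  have hspan : Submodule.span F {M, N} = P.space := by
    refine Submodule.eq_of_le_of_finrank_eq ?_ ?_
    · rw [Submodule.span_le, Set.pair_subset_iff]
      exact ⟨hc.fst_mem, hc.snd_mem⟩
    · rw [P.finrank_eq, ← Matrix.range_cons_cons_empty, finrank_span_eq_card hc.linearIndependent,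
        Fintype.card_fin]
  exact Submodule.mem_span_pair.1 (hspan ▸ hR)

lemma fst_ne_zero (hc : IsAffineChart P u M N e) : M ≠ 0 := by
  simpa using hc.linearIndependent.ne_zero 0

lemma smul_sub_ne_zero (hc : IsAffineChart P u M N e) (c : F) : c • M - N ≠ 0 := fun h => by
  have := (LinearIndependent.pair_iff.1 hc.linearIndependent c (-1) (by rw [← h]; module)).2
  simp at this

/-- The smooth member of the pencil at which the chart is based. -/
def center (hc : IsAffineChart P u M N e) : Conic F := .mk F M hc.fst_ne_zero

/-- The member of the pencil with coordinate `c` in a chart, which is degenerate if `c` is one of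
the `e i`. Every member other than the center has a coordinate. -/
def member (hc : IsAffineChart P u M N e) (c : F) : Conic F := .mk F _ (hc.smul_sub_ne_zero c)

lemma center_mem (hc : IsAffineChart P u M N e) : hc.center ∈ P.members :=
  (mk_mem_members _).2 hc.fst_mem

lemma member_mem (hc : IsAffineChart P u M N e) (c : F) : hc.member c ∈ P.members :=
  (mk_mem_members _).2 (hc.smul_sub_mem c)

lemma member_injective (hc : IsAffineChart P u M N e) : Function.Injective hc.member := by
  intro a b hab
  obtain ⟨k, hk⟩ := (Projectivization.mk_eq_mk_iff' F _ _ _ _).1 hab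
  obtain ⟨hM, hN⟩ := LinearIndependent.pair_iff.1 hc.linearIndependent (a - k * b) (k - 1) (by
    linear_combination (norm := module) -hk)
  rw [sub_eq_zero.1 hN, one_mul] at hM
  exact sub_eq_zero.1 hM

lemma eq_center_or_eq_member (hc : IsAffineChart P u M N e) {B : Conic F} (hB : B ∈ P.members) :
    B = hc.center ∨ ∃ c, B = hc.member c := by
  obtain ⟨x, y, hxy⟩ := hc.exists_eq hB
  by_cases hy : y = 0
  · left
    rw [← B.mk_rep, center, Projectivization.mk_eq_mk_iff']
    exact ⟨x, by rw [← hxy, hy, zero_smul, add_zero]⟩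
  · right
    refine ⟨-x / y, ?_⟩
    rw [← B.mk_rep, member, Projectivization.mk_eq_mk_iff']
    refine ⟨-y, ?_⟩
    rw [← hxy, smul_sub, smul_smul, neg_mul, mul_div_cancel₀ _ hy]
    module

lemma points_center_inter_points_member (hc : IsAffineChart P u M N e) (c : F) :
    hc.center.points K ∩ (hc.member c).points K = P.basePoints K := by
  refine Set.Subset.antisymm (fun X hX => mem_basePoints_iff_bil.2 fun R hR => ?_) fun X hX =>
    ⟨hX _ hc.center_mem, hX _ (hc.member_mem c)⟩
  have hM := (mem_points_mk hc.fst_ne_zero).1 hX.1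
  have hN := (mem_points_mk (hc.smul_sub_ne_zero c)).1 hX.2
  simp only [map_sub, map_smul, LinearMap.sub_apply, LinearMap.smul_apply, hM, smul_zero, zero_sub,
    neg_eq_zero] at hN
  obtain ⟨x, y, rfl⟩ := hc.exists_eq hR
  simp [hM, hN]

end IsAffineChart

lemma IsFrame.isSmooth_mk_iff (h : IsFrame P u) (h2 : (2 : K) ≠ 0) (hM : M ∈ P.space)
    (hM0 : M ≠ 0) :
    Conic.IsSmooth K (.mk F M hM0) ↔ ∀ i, splitForm u i M ≠ 0 := by
  obtain ⟨a, ha0, ha⟩ := exists_mat_mk (K := K) hM0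
  rw [← h.det_ne_zero_iff h2 hM, isSmooth_iff_det_ne_zero, ha, det_smul]
  simp [ha0]

namespace IsAffineChart

lemma isSmooth_center (hc : IsAffineChart P u M N e) (h : IsFrame P u) (h2 : (2 : K) ≠ 0) :
    hc.center.IsSmooth K :=
  (h.isSmooth_mk_iff h2 hc.fst_mem _).2 hc.splitForm_fst_ne_zero

lemma isSmooth_member_iff (hc : IsAffineChart P u M N e) (h : IsFrame P u) (h2 : (2 : K) ≠ 0)
    (c : F) : (hc.member c).IsSmooth K ↔ cubicEval (cubic e) (algebraMap F K c) ≠ 0 := by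
  rw [member, h.isSmooth_mk_iff h2 (hc.smul_sub_mem c), cubicEval_cubic, Finset.prod_ne_zero_iff]
  simp [hc.splitForm_smul_sub, hc.splitForm_fst_ne_zero]

theorem isStandard (hc : IsAffineChart P u M N e) (h : IsFrame P u) (h2 : (2 : K) ≠ 0) (c : F) :
    IsStandard hc.center (hc.member c) (frameMat u * rootMat e) (cubic e) (algebraMap F K c) := by
  obtain ⟨k, hk⟩ : ∃ k : K, (fun i => splitForm u i M) = k • fun i => e (i + 1) - e (i + 2) :=
    exists_eq_smul_sub_of_sum_eq_zero hc.injective (h.sum_splitForm h2 hc.fst_mem)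
      (by simpa only [hc.splitForm_snd] using h.sum_splitForm h2 hc.snd_mem)
  have hk' : (fun i => splitForm u i (c • M - N)) =
      k • fun i => (algebraMap F K c - e i) * (e (i + 1) - e (i + 2)) := by
    funext i
    have hi := congrFun hk i
    simp only [Pi.smul_apply, smul_eq_mul] at hi ⊢
    rw [hc.splitForm_smul_sub, hi]
    ring
  have hk0 : k ≠ 0 := by
    rintro rfl
    exact hc.splitForm_fst_ne_zero 0 (by simpa using congrFun hk 0)
  have hdet := det_rootMat_ne_zero hc.injective
  have hmul (G : Matrix (Fin 3) (Fin 3) K) : (frameMat u * rootMat e)ᵀ * G *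
      (frameMat u * rootMat e) = (rootMat e)ᵀ * ((frameMat u)ᵀ * G * frameMat u) * rootMat e := by
    simp only [transpose_mul, Matrix.mul_assoc]
  obtain ⟨a, ha0, ha⟩ := exists_mat_mk (K := K) hc.fst_ne_zero
  obtain ⟨b, hb0, hb⟩ := exists_mat_mk (K := K) (hc.smul_sub_ne_zero c)
  refine ⟨?_, ⟨a * (k * (rootMat e).det), by simp [ha0, hk0, hdet], ?_⟩,
    ⟨b * (k * (rootMat e).det), by simp [hb0, hk0, hdet], ?_⟩⟩
  · rw [det_mul]
    exact mul_ne_zero h.det_frameMat_ne_zero hdet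
  · rw [center, ha, Matrix.mul_smul, Matrix.smul_mul, hmul,
      h.frameMat_transpose_mul_mul hc.fst_mem, hk, coordinateConicMat_smul, Matrix.mul_smul,
      Matrix.smul_mul, rootMat_transpose_mul_veronese, mul_smul, mul_smul]
  · rw [member, hb, Matrix.mul_smul, Matrix.smul_mul, hmul,
      h.frameMat_transpose_mul_mul (hc.smul_sub_mem c), hk', coordinateConicMat_smul,
      Matrix.mul_smul, Matrix.smul_mul, rootMat_transpose_mul_pencil, mul_smul, mul_smul]

end IsAffineChart

end Charts

section Counting

variable {F : Type*} [Field F] {K : Type*} [Field K] [Algebra F K] [DecidableEq K]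

/-- The abscissas in `F` of the points of `E[n] ∖ E[2]`, for `E : y² = f(x)` over `K`. -/
def torsionAbscissas (F : Type*) [Field F] {K : Type*} [Field K] [Algebra F K] [DecidableEq K]
    (n : ℕ) (f : Polynomial K) : Set F :=
  {c | ∃ Q : (cubicCurve f).toAffine.Point,
    xCoord Q = some (algebraMap F K c) ∧ 2 • Q ≠ 0 ∧ n • Q = 0}

lemma mem_torsionPoints_iff {n : ℕ} {f : Polynomial K} {Q : (cubicCurve f).toAffine.Point} :
    Q ∈ torsionPoints F n f ↔
      n • Q = 0 ∧ 2 • Q ≠ 0 ∧ ∃ c : F, xCoord Q = some (algebraMap F K c) := by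
  refine and_congr_right fun _ => and_congr_right fun _ => exists_congr fun c => ?_
  constructor
  · rintro ⟨y, h, rfl⟩
    rfl
  · intro hc
    rcases Q with _ | ⟨x, y, h⟩ <;> cases hc
    exact ⟨y, h, rfl⟩

theorem torsionCount_eq_two_mul [Finite F] (n : ℕ) (f : Polynomial K) :
    torsionCount F n f = 2 * (torsionAbscissas F n f).ncard := by
  choose Q hx h2Q hnQ using fun c : torsionAbscissas F n f => c.2
  have eq_of_xCoord_eq {a b : torsionAbscissas F n f} (h : xCoord (Q a) = xCoord (Q b)) : a = b :=
    Subtype.ext ((algebraMap F K).injective (Option.some.inj ((hx a).symm.trans (h.trans (hx b)))))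
  have hinj : Function.Injective Q := fun a b h => eq_of_xCoord_eq (congrArg xCoord h)
  have hunion : torsionPoints F n f = Set.range Q ∪ Set.range (-Q) := by
    ext R
    rw [mem_torsionPoints_iff]
    constructor
    · rintro ⟨hn, h2, c, hc⟩
      have hR : xCoord R = xCoord (Q ⟨c, R, hc, h2, hn⟩) := hc.trans (hx ⟨c, R, hc, h2, hn⟩).symm
      exact (eq_or_eq_neg_of_xCoord_eq hR).imp (fun h => ⟨_, h.symm⟩) fun h => ⟨_, h.symm⟩
    · rintro (⟨c, rfl⟩ | ⟨c, rfl⟩)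
      · exact ⟨hnQ c, h2Q c, c, hx c⟩
      · simpa [xCoord_neg, hnQ c, hx c] using h2Q c
  have hdisj : Disjoint (Set.range Q) (Set.range (-Q)) := by
    rw [Set.disjoint_left]
    rintro _ ⟨a, rfl⟩ ⟨b, hb⟩
    obtain rfl : b = a := eq_of_xCoord_eq (by rw [← hb, Pi.neg_apply, xCoord_neg])
    exact h2Q b (by rw [two_nsmul, add_eq_zero_iff_eq_neg]; exact hb.symm)
  have hncard {g : torsionAbscissas F n f → (cubicCurve f).toAffine.Point}
      (hg : Function.Injective g) : (Set.range g).ncard = (torsionAbscissas F n f).ncard := by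
    rw [← Set.image_univ, Set.ncard_image_of_injective _ hg, Set.ncard_univ, Nat.card_coe_set_eq]
  rw [torsionCount, hunion, Set.ncard_union_eq hdisj, hncard hinj,
    hncard (g := -Q) (neg_injective.comp hinj), two_mul]

end Counting

section PonceletPairs

variable {F : Type*} [Field F] {K : Type*} [Field K] [Algebra F K] [IsAlgClosed K]
  {P : Pencil F} {u : Fin 4 → Fin 3 → K}

namespace IsAffineChart

variable {M N : symMatrices F} {e : Fin 3 → K}

lemma not_transversal_center (hc : IsAffineChart P u M N e) (h : IsFrame P u) (h2 : (2 : K) ≠ 0) :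
    ¬ Transversal K hc.center hc.center := by
  have : Infinite K := IsAlgClosed.instInfinite
  intro ht
  have hstd := hc.isStandard h h2 0
  rw [Transversal, Set.inter_self] at ht
  exact Set.infinite_of_injective_forall_mem hstd.point_injective hstd.point_mem_points
    (Set.finite_of_ncard_ne_zero (by simp [ht]))

variable [DecidableEq K]

lemma mem_ponceletPairs_iff (hc : IsAffineChart P u M N e) (h : IsFrame P u) (h2 : (2 : K) ≠ 0)
    (n : ℕ) (c : F) : (hc.center, hc.member c) ∈ P.ponceletPairs K n ↔
      c ∈ torsionAbscissas F n (cubic e) := by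
  have hsurj := xCoord_surjective_of_cubic h2 hc.injective
  have hsmooth := hc.isSmooth_member_iff h h2 c
  constructor
  · rintro ⟨-, -, -, hB, -, hponcelet⟩
    obtain ⟨Q, hQ⟩ := hsurj (some (algebraMap F K c))
    have h2Q : 2 • Q ≠ 0 := mt (two_nsmul_eq_zero_iff h2 hQ).1 (hsmooth.1 hB)
    exact ⟨Q, hQ, h2Q,
      ((hc.isStandard h h2 c).ponceletCondition_iff h2 hQ h2Q hsurj n).1 hponcelet⟩
  · rintro ⟨Q, hQ, h2Q, hnQ⟩
    have htransversal : Transversal K hc.center (hc.member c) := by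
      rw [Transversal, hc.points_center_inter_points_member, h.ncard_basePoints]
    exact ⟨hc.center_mem, hc.member_mem c, hc.isSmooth_center h h2,
      hsmooth.2 (mt (two_nsmul_eq_zero_iff h2 hQ).2 h2Q), htransversal,
      ((hc.isStandard h h2 c).ponceletCondition_iff h2 hQ h2Q hsurj n).2 hnQ⟩

theorem ncard_partners_center (hc : IsAffineChart P u M N e) (h : IsFrame P u) (h2 : (2 : K) ≠ 0)
    (n : ℕ) : {B | (hc.center, B) ∈ P.ponceletPairs K n}.ncard =
      (torsionAbscissas F n (cubic e)).ncard := by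
  rw [← Set.ncard_image_of_injective _ hc.member_injective]
  congr 1
  ext B
  constructor
  · intro hB
    rcases hc.eq_center_or_eq_member hB.2.1 with rfl | ⟨c, rfl⟩
    · exact absurd hB.2.2.2.2.1 (hc.not_transversal_center h h2)
    · exact ⟨c, (hc.mem_ponceletPairs_iff h h2 n c).1 hB, rfl⟩
  · rintro ⟨c, hcn, rfl⟩
    exact (hc.mem_ponceletPairs_iff h h2 n c).2 hcn

end IsAffineChart

theorem IsFrame.ncard_ponceletPairs [DecidableEq K] [Finite F] (h : IsFrame P u) (h2 : (2 : K) ≠ 0)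
    {Λ : Type*} [Fintype Λ] {M N : Λ → symMatrices F} {e : Λ → Fin 3 → K}
    (hc : ∀ l, IsAffineChart P u (M l) (N l) (e l))
    (hM : ∀ R ∈ P.space, (∀ i, splitForm u i R ≠ 0) → ∃! l, ∃ a : F, a • M l = R) (n : ℕ) :
    ((P.ponceletPairs K n).ncard : ℚ) = 1 / 2 * ∑ l, (torsionCount F n (cubic (e l)) : ℚ) := by
  have hinj : Function.Injective fun l => (hc l).center := by
    intro l l' hl
    obtain ⟨a, ha⟩ := (Projectivization.mk_eq_mk_iff' F _ _ _ _).1 hl.symm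
    exact (hM (M l') (hc l').fst_mem (hc l').splitForm_fst_ne_zero).unique
      ⟨a, ha⟩ ⟨1, one_smul F _⟩
  have hiUnion : P.ponceletPairs K n =
      ⋃ l, Prod.mk (hc l).center '' {B | ((hc l).center, B) ∈ P.ponceletPairs K n} := by
    ext ⟨A, B⟩
    simp only [Set.mem_iUnion]
    constructor
    · intro hAB
      have hA : Conic.IsSmooth K A := hAB.2.2.1
      rw [isSmooth_iff_det_ne_zero, Conic.mat, h.det_ne_zero_iff h2 hAB.1] at hA
      obtain ⟨l, ⟨a, ha⟩, -⟩ := hM _ hAB.1 hA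
      obtain rfl : A = (hc l).center := by
        rw [← A.mk_rep]
        exact (Projectivization.mk_eq_mk_iff' F _ _ _ _).2 ⟨a, ha⟩
      exact ⟨l, B, hAB, rfl⟩
    · rintro ⟨l, B', hB', heq⟩
      exact heq ▸ hB'
  have hncard : (P.ponceletPairs K n).ncard =
      ∑ l, {B | ((hc l).center, B) ∈ P.ponceletPairs K n}.ncard := by
    have : Finite (Conic F) := Quotient.finite _
    conv_lhs => rw [hiUnion]
    rw [Set.ncard_iUnion_of_finite (fun l => Set.toFinite _), finsum_eq_sum_of_fintype]
    · exact Finset.sum_congr rfl fun l _ =>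
        Set.ncard_image_of_injective _ (Prod.mk_right_injective _)
    · intro l l' hll
      rw [Function.onFun, Set.disjoint_left]
      rintro _ ⟨B, -, rfl⟩ ⟨B', -, hB'⟩
      exact hll (hinj (congrArg Prod.fst hB').symm)
  rw [hncard, Nat.cast_sum, Finset.mul_sum]
  refine Finset.sum_congr rfl fun l _ => ?_
  rw [(hc l).ncard_partners_center h h2, torsionCount_eq_two_mul]
  push_cast
  ring

end PonceletPairs

section CycleTypes

open Equiv

lemma cycleType_eq_filter_of_parts_eq {σ : Perm (Fin 4)} {μ : Multiset ℕ}
    (h : σ.partition.parts = μ) : σ.cycleType = μ.filter (2 ≤ ·) := by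
  rw [← h, Perm.filter_parts_partition_eq_cycleType]

theorem exists_actsOnSplittings_one {σ : Perm (Fin 4)}
    (h : σ.partition.parts = {1, 1, 1, 1} ∨ σ.partition.parts = {2, 2}) :
    ∃ π : Perm (Fin 4), ActsOnSplittings (π⁻¹ * σ * π) 1 := by
  have even_involution : ∀ σ : Perm (Fin 4), σ ^ 2 = 1 → Perm.sign σ = 1 →
      ∀ a b, a ≠ b → splitting (σ a) (σ b) = splitting a b := by decide
  refine ⟨1, ?_⟩
  rw [inv_one, one_mul, mul_one]
  rcases h with h | h <;> have hc := cycleType_eq_filter_of_parts_eq h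
  · obtain rfl : σ = 1 := Perm.cycleType_eq_zero.1 (hc.trans (by decide))
    exact fun _ _ _ => rfl
  · refine even_involution σ ?_ ?_
    · rw [← orderOf_dvd_iff_pow_eq_one, ← Perm.lcm_cycleType, hc]
      decide
    · rw [Perm.sign_of_cycleType, hc]
      decide

theorem exists_actsOnSplittings_swap {σ : Perm (Fin 4)}
    (h : σ.partition.parts = {2, 1, 1} ∨ σ.partition.parts = {4}) :
    ∃ π : Perm (Fin 4), ActsOnSplittings (π⁻¹ * σ * π) (swap 1 2) := by
  have odd : ∀ σ : Perm (Fin 4), Perm.sign σ = -1 → ∃ π : Perm (Fin 4), ∀ a b, a ≠ b →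
      splitting ((π⁻¹ * σ * π) a) ((π⁻¹ * σ * π) b) = swap 1 2 (splitting a b) := by decide
  apply odd
  rcases h with h | h <;> rw [Perm.sign_of_cycleType, cycleType_eq_filter_of_parts_eq h] <;> decide

theorem exists_actsOnSplittings_finRotate {σ : Perm (Fin 4)} (h : σ.partition.parts = {3, 1}) :
    ∃ π : Perm (Fin 4), ActsOnSplittings (π⁻¹ * σ * π) (finRotate 3) := by
  have order_three : ∀ σ : Perm (Fin 4), σ ^ 3 = 1 → σ ≠ 1 → ∃ π : Perm (Fin 4), ∀ a b, a ≠ b →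
      splitting ((π⁻¹ * σ * π) a) ((π⁻¹ * σ * π) b) = finRotate 3 (splitting a b) := by decide
  have hc : σ.cycleType = {3} := (cycleType_eq_filter_of_parts_eq h).trans (by decide)
  refine order_three σ ?_ ?_
  · rw [← orderOf_dvd_iff_pow_eq_one, ← Perm.lcm_cycleType, hc]
    decide
  · rintro rfl
    simp at hc

end CycleTypes

section BinaryForms

open Polynomial in
lemma mem_range_of_pow_card_eq {F : Type*} [Field F] [Fintype F] {K : Type*} [Field K]
    [Algebra F K] {x : K} (hx : x ^ Fintype.card F = x) : x ∈ Set.range (algebraMap F K) := by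
  have hsplits : (X ^ Fintype.card F - X : F[X]).Splits := by
    rw [splits_iff_card_roots, FiniteField.roots_X_pow_card_sub_X,
      FiniteField.X_pow_card_sub_X_natDegree_eq F Fintype.one_lt_card]
    rfl
  exact hsplits.mem_range_of_isRoot (FiniteField.X_pow_card_sub_X_ne_zero F Fintype.one_lt_card)
    (by simp [hx])

variable {F : Type*} [Field F] {K : Type*} [Field K] [Algebra F K]

/-- The determinant of two vectors of the plane `K²`: it vanishes exactly when they give the same
point of the projective line. -/
def cross (v w : Fin 2 → K) : K := v 0 * w 1 - v 1 * w 0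

lemma cross_smul_left (c : K) (v w : Fin 2 → K) : cross (c • v) w = c * cross v w := by
  simp only [cross, Pi.smul_apply, smul_eq_mul]
  ring

lemma cross_smul_right (c : K) (v w : Fin 2 → K) : cross v (c • w) = c * cross v w := by
  simp only [cross, Pi.smul_apply, smul_eq_mul]
  ring

lemma linearIndependent_of_cross_ne_zero {w : Fin 2 → Fin 2 → K} (h : cross (w 0) (w 1) ≠ 0) :
    LinearIndependent K w :=
  Matrix.linearIndependent_rows_of_det_ne_zero (A := w) ((Matrix.det_fin_two w).trans_ne h)

lemma eq_of_cross_eq {v v' w w' : Fin 2 → K} (h : cross w w' ≠ 0) (hw : cross v w = cross v' w)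
    (hw' : cross v w' = cross v' w') : v = v' := by
  ext i
  refine mul_right_cancel₀ h ?_
  simp only [cross] at *
  fin_cases i <;> simp only [Fin.zero_eta, Fin.mk_one]
  · linear_combination w 0 * hw' - w' 0 * hw
  · linear_combination w 1 * hw' - w' 1 * hw

/-- The linear form on `F²` which vanishes at the point `w` of the projective line over `K`. -/
def crossForm (w : Fin 2 → K) : (Fin 2 → F) →ₗ[F] K where
  toFun v := cross (algebraMap F K ∘ v) w
  map_add' v v' := by
    simp only [cross, Function.comp_apply, Pi.add_apply, map_add]
    ring
  map_smul' a v := by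
    simp only [cross, Function.comp_apply, Pi.smul_apply, smul_eq_mul, map_mul, RingHom.id_apply]
    rw [Algebra.smul_def]
    ring

lemma crossForm_apply (w : Fin 2 → K) (v : Fin 2 → F) :
    crossForm w v = algebraMap F K (v 0) * w 1 - algebraMap F K (v 1) * w 0 :=
  rfl

lemma eq_of_crossForm_eq {v v' : Fin 2 → F} {w w' : Fin 2 → K} (h : cross w w' ≠ 0)
    (hw : crossForm w v = crossForm w v') (hw' : crossForm w' v = crossForm w' v') : v = v' :=
  (algebraMap F K).injective.comp_left (eq_of_cross_eq h hw hw')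

theorem exists_smul_frobPermutes [Fintype F] [IsAlgClosed K] {p : Fin 3 → Fin 2 → K}
    (hp : Pairwise fun i j => cross (p i) (p j) ≠ 0) {τ : Equiv.Perm (Fin 3)}
    (hτ : FrobPermutes F p τ) : ∃ μ : Fin 3 → K, (∀ i, μ i ≠ 0) ∧ ∑ i, μ i • p i = 0 ∧
      FrobPermutes F (fun i => μ i • p i) τ := by
  have hdep : ¬ LinearIndependent K p := fun h => by
    simpa using h.fintype_card_le_finrank
  have hind (i : Fin 3) : LinearIndependent K (p ∘ i.succAbove) :=
    linearIndependent_of_cross_ne_zero (hp (Fin.succAbove_right_injective.ne (by decide)))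
  obtain ⟨g, hg, hcircuit⟩ := exists_isCircuit_smul hdep hind
  obtain ⟨c, hc, hfrob⟩ := hcircuit.exists_frobPermutes_smul (F := F) (σ := τ) fun i =>
    ⟨g i ^ Fintype.card F / g (τ i), fun j => by
      simp only [Pi.smul_apply, smul_eq_mul, mul_pow, hτ i j]
      field_simp [hg (τ i)]⟩
  refine ⟨c • g, fun i => mul_ne_zero hc (hg i), ?_, ?_⟩
  · simpa [mul_smul] using (hcircuit.const_smul hc).sum_eq_zero
  · simpa [FrobPermutes, mul_assoc] using hfrob

theorem exists_crossForm_eq [Fintype F] {w : Fin 3 → Fin 2 → K} {τ : Equiv.Perm (Fin 3)}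
    (hw : FrobPermutes F w τ) (hsum : ∑ i, w i = 0) (h01 : cross (w 0) (w 1) ≠ 0) {L : Fin 3 → K}
    (hL : ∀ i, L i ^ Fintype.card F = L (τ i)) (hLsum : ∑ i, L i = 0) :
    ∃ v : Fin 2 → F, ∀ i, crossForm (w i) v = L i := by
  set x : Fin 2 → K := (cross (w 0) (w 1))⁻¹ • (L 1 • w 0 - L 0 • w 1) with hx
  have hcross (i : Fin 3) : cross x (w i) = L i := by
    have hw2 : w 2 = -(w 0 + w 1) := by
      rw [eq_neg_iff_add_eq_zero, ← hsum, Fin.sum_univ_three, add_comm]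
    have hL2 : L 2 = -(L 0 + L 1) := by
      rw [eq_neg_iff_add_eq_zero, ← hLsum, Fin.sum_univ_three, add_comm]
    rw [hx, ← mul_right_inj' h01, cross_smul_left, mul_inv_cancel_left₀ h01]
    fin_cases i <;>
      simp only [Fin.zero_eta, Fin.mk_one, Fin.reduceFinMk, hw2, hL2, cross, Pi.sub_apply,
        Pi.smul_apply, Pi.neg_apply, Pi.add_apply, smul_eq_mul] <;>
      ring
  have hfrob (i : Fin 3) : cross (fun j => x j ^ Fintype.card F) (w i) = L i := by
    obtain ⟨i, rfl⟩ := τ.surjective i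
    rw [← hL, ← hcross, cross, cross, ← hw, ← hw]
    simpa [mul_pow] using
      (map_sub (FiniteField.frobeniusAlgHom F K) (x 0 * w i 1) (x 1 * w i 0)).symm
  have hfixed : (fun j => x j ^ Fintype.card F) = x :=
    eq_of_cross_eq h01 ((hfrob 0).trans (hcross 0).symm) ((hfrob 1).trans (hcross 1).symm)
  choose v hv using fun j => mem_range_of_pow_card_eq (F := F) (congrFun hfixed j)
  exact ⟨v, fun i => (congrArg (cross · (w i)) (funext hv)).trans (hcross i)⟩

end BinaryForms

section PencilCoordinates

variable {F : Type*} [Field F] [Fintype F] {K : Type*} [Field K] [Algebra F K]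
  {P : Pencil F} {u : Fin 4 → Fin 3 → K} {τ : Equiv.Perm (Fin 3)} {p : Fin 3 → Fin 2 → K}

/-- The Frobenius permutes the degenerate members of `P`, hence the linear forms vanishing at them,
by `τ`. -/
def FrobPermutesSplitForms (P : Pencil F) (u : Fin 4 → Fin 3 → K) (τ : Equiv.Perm (Fin 3)) : Prop :=
  ∀ M ∈ P.space, ∀ i, splitForm u i M ^ Fintype.card F = splitForm u (τ i) M

theorem Pencil.HasType.exists_isFrame [IsAlgClosed K] {ν : Multiset ℕ} (h : P.HasType K ν)
    (h2 : (2 : K) ≠ 0) (hν : ∀ {σ : Equiv.Perm (Fin 4)}, σ.partition.parts = ν →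
      ∃ π : Equiv.Perm (Fin 4), ActsOnSplittings (π⁻¹ * σ * π) τ) :
    ∃ u : Fin 4 → Fin 3 → K, IsFrame P u ∧ FrobPermutesSplitForms P u τ := by
  obtain ⟨p, σ, hp, hP, hσ, hparts⟩ := h
  obtain ⟨u, hu, hfrob⟩ := exists_isFrame_frobPermutes h2 hp hP hσ
  obtain ⟨π, hπ⟩ := hν hparts
  exact ⟨u ∘ π, hu.comp_perm π, fun _ hM =>
    (hu.comp_perm π).splitForm_pow_card h2 (hfrob.comp_perm π) hπ hM⟩

namespace IsFrame

theorem exists_linearEquiv_splitForm [IsAlgClosed K] (h : IsFrame P u) (h2 : (2 : K) ≠ 0)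
    (hτ : FrobPermutesSplitForms P u τ)
    (hp : Pairwise fun i j => cross (p i) (p j) ≠ 0) (hpτ : FrobPermutes F p τ) :
    ∃ (Φ : (Fin 2 → F) ≃ₗ[F] P.space) (μ : Fin 3 → K), (∀ i, μ i ≠ 0) ∧
      ∀ v i, splitForm u i (Φ v : symMatrices F) = μ i * crossForm (p i) v := by
  obtain ⟨μ, hμ, hsum, hμτ⟩ := exists_smul_frobPermutes hp hpτ
  have crossForm_smul (v : Fin 2 → F) (i : Fin 3) :
      crossForm (μ i • p i) v = μ i * crossForm (p i) v := cross_smul_right _ _ _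
  have h01 : cross (μ 0 • p 0) (μ 1 • p 1) ≠ 0 := by
    rw [cross_smul_left, cross_smul_right]
    exact mul_ne_zero (hμ 0) (mul_ne_zero (hμ 1) (hp (by decide)))
  let S : P.space →ₗ[F] Fin 3 → K := LinearMap.pi fun i => splitForm u i ∘ₗ P.space.subtype
  let T : (Fin 2 → F) →ₗ[F] Fin 3 → K := LinearMap.pi fun i => crossForm (μ i • p i)
  have hS : Function.Injective S := LinearMap.ker_eq_bot.1 <| LinearMap.ker_eq_bot'.2 fun M hM =>
    Subtype.ext (h.eq_zero_of_splitForm_eq_zero M.2 (congrFun hM))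
  have hT : Function.Injective T := fun v v' hv =>
    eq_of_crossForm_eq h01 (congrFun hv 0) (congrFun hv 1)
  have hle : LinearMap.range S ≤ LinearMap.range T := by
    rintro _ ⟨M, rfl⟩
    obtain ⟨v, hv⟩ := exists_crossForm_eq hμτ hsum h01
      (hτ M M.2) (h.sum_splitForm h2 M.2)
    exact ⟨v, funext hv⟩
  have hrange : LinearMap.range S = LinearMap.range T := by
    refine Submodule.eq_of_le_of_finrank_eq hle ?_
    rw [LinearMap.finrank_range_of_inj hS, LinearMap.finrank_range_of_inj hT, P.finrank_eq,
      Module.finrank_fin_fun]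
  let Φ := LinearEquiv.ofInjective T hT ≪≫ₗ LinearEquiv.ofEq _ _ hrange.symm ≪≫ₗ
    (LinearEquiv.ofInjective S hS).symm
  have hΦ (v : Fin 2 → F) : S (Φ v) = T v :=
    congrArg Subtype.val ((LinearEquiv.ofInjective S hS).apply_symm_apply _)
  exact ⟨Φ, μ, hμ, fun v i => (congrFun (hΦ v) i).trans (crossForm_smul v i)⟩

theorem ncard_ponceletPairs_of_crossForm [IsAlgClosed K] [DecidableEq K] (h : IsFrame P u)
    (h2 : (2 : K) ≠ 0) (hτ : FrobPermutesSplitForms P u τ)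
    (hp : Pairwise fun i j => cross (p i) (p j) ≠ 0) (hpτ : FrobPermutes F p τ)
    {Λ : Type*} [Fintype Λ] {m m' : Λ → Fin 2 → F} {e : Λ → Fin 3 → K}
    (hmm' : ∀ l, cross (m l) (m' l) ≠ 0)
    (hmp : ∀ l i, crossForm (p i) (m l) ≠ 0)
    (he : ∀ l i, crossForm (p i) (m' l) = e l i * crossForm (p i) (m l))
    (hm : ∀ v, (∀ i, crossForm (p i) v ≠ 0) → ∃! l, ∃ a : F, a • m l = v) (n : ℕ) :
    ((P.ponceletPairs K n).ncard : ℚ) = 1 / 2 * ∑ l, (torsionCount F n (cubic (e l)) : ℚ) := by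
  obtain ⟨Φ, μ, hμ, hΦ⟩ := h.exists_linearEquiv_splitForm h2 hτ hp hpτ
  refine h.ncard_ponceletPairs h2 (M := fun l => Φ (m l)) (N := fun l => Φ (m' l))
    (fun l => ⟨(Φ _).2, (Φ _).2, ?_, ?_, ?_⟩) ?_ n
  · intro i j hij
    by_contra hne
    refine mul_ne_zero ((map_ne_zero (algebraMap F K)).2 (hmm' l)) (hp hne) ?_
    have hcross : crossForm (p i) (m' l) * crossForm (p j) (m l) =
        crossForm (p j) (m' l) * crossForm (p i) (m l) := by
      rw [he, he, hij]
      ring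
    simp only [crossForm_apply, cross, map_sub, map_mul] at hcross ⊢
    linear_combination -hcross
  · intro i
    rw [hΦ]
    exact mul_ne_zero (hμ i) (hmp l i)
  · intro i
    rw [hΦ, hΦ, he, mul_left_comm]
  · intro R hR hRne
    obtain ⟨v, hv⟩ := Φ.surjective ⟨R, hR⟩
    obtain rfl : R = Φ v := congrArg Subtype.val hv.symm
    have hiff (l : Λ) : (∃ a : F, a • (Φ (m l) : symMatrices F) = Φ v) ↔ ∃ a : F, a • m l = v :=
      exists_congr fun a => by
        rw [← Submodule.coe_smul, ← map_smul, Subtype.coe_inj, Φ.injective.eq_iff]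
    simp only [hiff]
    refine hm v fun i => right_ne_zero_of_mul (a := μ i) ?_
    rw [← hΦ]
    exact hRne i

end IsFrame

end PencilCoordinates

section Families

variable {F : Type*} [Field F]

lemma pow_pow_eq_of_finRotate {M : Type*} [Monoid M] {q : ℕ} {α : M} (hα : α ^ q ^ 3 = α)
    (i : Fin 3) :
    (α ^ q ^ (i : ℕ)) ^ q = α ^ q ^ (finRotate 3 i : ℕ) := by
  rw [← pow_mul, ← pow_succ]
  fin_cases i
  exacts [rfl, rfl, hα.trans (by simp)]

lemma exists_smul_eq_iff {v : Fin 2 → F} (hv : v 1 ≠ 0) {l : F} :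
    (∃ a : F, a • ![l, 1] = v) ↔ l = v 0 / v 1 := by
  constructor
  · rintro ⟨a, rfl⟩
    have ha : a ≠ 0 := by simpa using hv
    simp [ha]
  · rintro rfl
    refine ⟨v 1, funext fun i => ?_⟩
    fin_cases i <;> simp [mul_div_cancel₀, hv]

lemma existsUnique_option_smul_eq {v : Fin 2 → F} (hv : v ≠ 0) :
    ∃! l : Option F, ∃ a : F, a • (l.elim ![1, 0] fun l => ![-l, 1] : Fin 2 → F) = v := by
  by_cases hv1 : v 1 = 0
  · refine ⟨none, ⟨v 0, by ext i; fin_cases i <;> simp [hv1]⟩, ?_⟩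
    rintro (_ | l) ⟨a, rfl⟩
    · rfl
    · obtain rfl : a = 0 := by simpa using hv1
      simp at hv
  · refine ⟨some (-(v 0 / v 1)), ?_, ?_⟩
    · simpa only [Option.elim, neg_neg] using (exists_smul_eq_iff hv1).2 rfl
    · rintro (_ | l) hl
      · obtain ⟨a, rfl⟩ := hl
        simp at hv1
      · rw [← (exists_smul_eq_iff hv1).1 hl, neg_neg]

variable {K : Type*} [Field K] [Algebra F K]

lemma crossForm_cons_one_ne_zero {a : K} (ha : a ∉ Set.range (algebraMap F K)) {v : Fin 2 → F}
    (hv : v 1 ≠ 0) : crossForm ![a, 1] v ≠ 0 := by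
  refine fun h => ha ⟨v 0 / v 1, ?_⟩
  rw [map_div₀, div_eq_iff (by simpa using hv)]
  simpa [crossForm_apply, sub_eq_zero, mul_comm] using h

variable [Fintype F]

lemma pow_card_eq_neg_of_not_isSquare {b : F} (hb : ¬ IsSquare b) {β : K}
    (hβ : β ^ 2 = algebraMap F K b) : β ^ Fintype.card F = -β := by
  have hsq : (β ^ Fintype.card F) ^ 2 = β ^ 2 := by
    rw [pow_right_comm, hβ, ← map_pow, FiniteField.pow_card]
  refine (sq_eq_sq_iff_eq_or_eq_neg.1 hsq).resolve_left fun h => hb ?_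
  obtain ⟨a, rfl⟩ := mem_range_of_pow_card_eq (F := F) h
  exact ⟨a, (algebraMap F K).injective (by rw [← hβ, map_mul, sq])⟩

section Conjugates

variable {α : Fin 3 → K}

lemma notMem_range_of_finRotate (hα : ∀ i, α i ^ Fintype.card F = α (finRotate 3 i))
    (hα0 : α 0 ∉ Set.range (algebraMap F K)) (i : Fin 3) : α i ∉ Set.range (algebraMap F K) := by
  have of_finRotate (i : Fin 3) (h : α (finRotate 3 i) ∉ Set.range (algebraMap F K)) :
      α i ∉ Set.range (algebraMap F K) := by
    rintro ⟨a, ha⟩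
    exact h ⟨a, by rw [← hα, ← ha, ← map_pow, FiniteField.pow_card]⟩
  have h2 : α 2 ∉ Set.range (algebraMap F K) := of_finRotate 2 hα0
  fin_cases i
  exacts [hα0, of_finRotate 1 h2, h2]

lemma injective_of_finRotate (hα : ∀ i, α i ^ Fintype.card F = α (finRotate 3 i))
    (hα0 : α 0 ∉ Set.range (algebraMap F K)) : Function.Injective α := by
  have hne (i : Fin 3) : α i ≠ α (finRotate 3 i) := fun h =>
    notMem_range_of_finRotate hα hα0 i (mem_range_of_pow_card_eq ((hα i).trans h.symm))
  intro i j hij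
  by_contra h
  obtain rfl | rfl : j = finRotate 3 i ∨ i = finRotate 3 j := by
    clear hij
    revert i j
    decide
  exacts [hne i hij, hne j hij.symm]

end Conjugates

variable {P : Pencil F} {u : Fin 4 → Fin 3 → K} [IsAlgClosed K] [DecidableEq K]

namespace IsFrame

theorem ncard_ponceletPairs_of_one [DecidableEq F] (h : IsFrame P u) (h2 : (2 : K) ≠ 0)
    (hτ : FrobPermutesSplitForms P u 1) (n : ℕ) :
    ((P.ponceletPairs K n).ncard : ℚ) = 1 / 2 * ∑ l : {l : F // l ≠ 0 ∧ l ≠ 1},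
      (torsionCount F n (cubic ![0, 1, algebraMap F K l]) : ℚ) := by
  let p : Fin 3 → Fin 2 → K := ![![1, 1], ![0, 1], ![1, 0]]
  have hp : Pairwise fun i j => cross (p i) (p j) ≠ 0 := by
    intro i j hij
    fin_cases i <;> fin_cases j <;> simp [p, cross] at hij ⊢
  have hpτ : FrobPermutes F p 1 := by
    intro i j
    fin_cases i <;> fin_cases j <;> simp [p]
  have forms_ne_zero (v : Fin 2 → F) :
      (∀ i, crossForm (p i) v ≠ 0) ↔ v 0 ≠ v 1 ∧ v 0 ≠ 0 ∧ v 1 ≠ 0 := by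
    simp [Fin.forall_fin_succ, crossForm_apply, p, sub_eq_zero, eq_comm (a := (0 : K))]
  refine h.ncard_ponceletPairs_of_crossForm h2 hτ hp hpτ
    (m := fun l : {l : F // l ≠ 0 ∧ l ≠ 1} => ![(l : F), 1]) (m' := fun l => ![(l : F), l])
    (fun l => ?_) (fun l => ?_) (fun l i => ?_) (fun v hv => ?_) n
  · have hl : (l : F) - 1 ≠ 0 := sub_ne_zero.2 l.2.2
    simpa [cross, ← mul_sub_one] using ⟨l.2.1, hl⟩
  · exact (forms_ne_zero _).2 ⟨l.2.2, l.2.1, one_ne_zero⟩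
  · fin_cases i <;> simp [crossForm_apply, p]
  · obtain ⟨hv01, hv0, hv1⟩ := (forms_ne_zero v).1 hv
    simp only [exists_smul_eq_iff hv1]
    exact ⟨⟨v 0 / v 1, div_ne_zero hv0 hv1, mt (div_eq_one_iff_eq hv1).1 hv01⟩, rfl,
      fun l hl => Subtype.ext hl⟩

theorem ncard_ponceletPairs_of_swap (h : IsFrame P u) (h2 : (2 : K) ≠ 0)
    (hτ : FrobPermutesSplitForms P u (Equiv.swap 1 2)) {b : F} (hb : ¬ IsSquare b) {β : K}
    (hβ : β ^ 2 = algebraMap F K b) (n : ℕ) :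
    ((P.ponceletPairs K n).ncard : ℚ) = 1 / 2 * ∑ l : F,
      (torsionCount F n (cubic ![algebraMap F K l, β, -β]) : ℚ) := by
  let p : Fin 3 → Fin 2 → K := ![![1, 0], ![-β, 1], ![β, 1]]
  have hfrob : β ^ Fintype.card F = -β := pow_card_eq_neg_of_not_isSquare hb hβ
  have hfrob_neg : (-β) ^ Fintype.card F = - -β :=
    pow_card_eq_neg_of_not_isSquare hb ((neg_sq β).trans hβ)
  have hsq (l : F) : l ^ 2 ≠ b := fun hl => hb ⟨l, by rw [← hl, sq]⟩
  have hβ0 : β ≠ 0 := by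
    rintro rfl
    simpa using hsq 0 ((algebraMap F K).injective (by rw [← hβ, map_pow, map_zero]))
  have hp : Pairwise fun i j => cross (p i) (p j) ≠ 0 := by
    intro i j hij
    fin_cases i <;> fin_cases j <;> simp [p, cross, ← two_mul, ← neg_add', h2, hβ0] at hij ⊢
  have hpτ : FrobPermutes F p (Equiv.swap 1 2) := by
    intro i j
    fin_cases i <;> fin_cases j <;> simp [p, hfrob, hfrob_neg, Equiv.swap_apply_def]
  have hne (l : F) : ¬ (algebraMap F K l = β ∨ algebraMap F K l = -β) := by
    rw [← sq_eq_sq_iff_eq_or_eq_neg, hβ, ← map_pow, (algebraMap F K).injective.eq_iff]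
    exact hsq l
  refine h.ncard_ponceletPairs_of_crossForm h2 hτ hp hpτ (m := fun l => ![l, 1])
    (m' := fun l => ![b, l]) (fun l => ?_) (fun l i => ?_) (fun l i => ?_) (fun v hv => ?_) n
  · simpa [cross, ← sq, sub_eq_zero] using hsq l
  · obtain ⟨hl, hl'⟩ := not_or.1 (hne l)
    fin_cases i <;> simp [crossForm_apply, p, sub_eq_zero, ← eq_neg_iff_add_eq_zero, hl, hl']
  · fin_cases i <;> simp [crossForm_apply, p, ← hβ] <;> ring
  · have hv1 : v 1 ≠ 0 := by simpa [crossForm_apply, p] using hv 0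
    simp only [exists_smul_eq_iff hv1]
    exact existsUnique_eq

theorem ncard_ponceletPairs_of_finRotate [DecidableEq F] (h : IsFrame P u) (h2 : (2 : K) ≠ 0)
    (hτ : FrobPermutesSplitForms P u (finRotate 3)) {α : Fin 3 → K}
    (hα : ∀ i, α i ^ Fintype.card F = α (finRotate 3 i))
    (hα0 : α 0 ∉ Set.range (algebraMap F K)) (n : ℕ) :
    ((P.ponceletPairs K n).ncard : ℚ) = 1 / 2 *
      (∑ l : {l : F // l ≠ 0}, (torsionCount F n
          (cubic fun i => α i / (α i + algebraMap F K l)) : ℚ) +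
        torsionCount F n (cubic fun i => (α i)⁻¹) + torsionCount F n (cubic α)) := by
  let p : Fin 3 → Fin 2 → K := fun i => ![α i, 1]
  have hp : Pairwise fun i j => cross (p i) (p j) ≠ 0 := fun i j hij => by
    simpa [cross, p, sub_eq_zero] using (injective_of_finRotate hα hα0).ne hij
  have hpτ : FrobPermutes F p (finRotate 3) := fun i j => by fin_cases j <;> simp [p, hα]
  have hmem (i : Fin 3) := notMem_range_of_finRotate hα hα0 i
  have hα_ne (i : Fin 3) : α i ≠ 0 := fun h => hmem i ⟨0, by rw [h, map_zero]⟩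
  have hαl (i : Fin 3) (l : F) : α i + algebraMap F K l ≠ 0 := fun h =>
    hmem i ⟨-l, by rw [map_neg, ← eq_neg_of_add_eq_zero_left h]⟩
  let m' : Option F → Fin 2 → F := fun l => l.elim ![0, -1] fun l =>
    if l = 0 then ![-1, 0] else ![0, 1]
  let e : Option F → Fin 3 → K := fun l i => l.elim (α i) fun l =>
    if l = 0 then (α i)⁻¹ else α i / (α i + algebraMap F K l)
  have e_some {l : F} (hl : l ≠ 0) : e (some l) = fun i => α i / (α i + algebraMap F K l) :=
    funext fun i => if_neg hl
  have e_zero : e (some 0) = fun i => (α i)⁻¹ := funext fun i => if_pos rfl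
  rw [h.ncard_ponceletPairs_of_crossForm h2 hτ hp hpτ (m' := m') (e := e)
      (m := fun l => l.elim ![1, 0] fun l => ![-l, 1])
      ?_ ?_ ?_ (fun v hv => existsUnique_option_smul_eq ?_),
    Fintype.sum_option, Fintype.sum_eq_add_sum_subtype_ne _ (0 : F), e_zero]
  · simp only [fun l : {l : F // l ≠ 0} => e_some l.2]
    change 1 / 2 * ((torsionCount F n (cubic α) : ℚ) + _) = _
    ring
  · rintro (_ | l)
    · simp [cross, m']
    · by_cases hl : l = 0 <;> simp [cross, m', hl]
  · rintro (_ | l) i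
    · simp [crossForm_apply, p]
    · exact crossForm_cons_one_ne_zero (hmem i) one_ne_zero
  · rintro (_ | l) i
    · simp [crossForm_apply, m', e, p]
    · by_cases hl : l = 0
      · simp [crossForm_apply, m', e, p, hl, hα_ne]
      · have := hαl i l
        simp only [crossForm_apply, m', e, p, hl, Option.elim, if_false, Matrix.cons_val, map_zero,
          map_one, map_neg]
        field
  · rintro rfl
    simpa using hv 0

end IsFrame

end Families

end Poncelet

end

open Poncelet Polynomial in
theorem mainTheorem8_general {F : Type*} [Field F] [Fintype F] [DecidableEq F]
    {K : Type*} [Field K] [DecidableEq K] [Algebra F K] [IsAlgClosed K]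
    (hchar : ringChar F ≠ 2) (n : ℕ) (P : Pencil F) :
    ((P.HasType K {1, 1, 1, 1} ∨ P.HasType K {2, 2}) →
      ((P.ponceletPairs K n).ncard : ℚ) =
        1 / 2 * ∑ l : {l : F // l ≠ 0 ∧ l ≠ 1},
          (torsionCount F n (X * (X - 1) * (X - C (algebraMap F K l))) : ℚ)) ∧
    ((P.HasType K {2, 1, 1} ∨ P.HasType K {4}) →
      ∀ b : F, ¬ IsSquare b →
        ((P.ponceletPairs K n).ncard : ℚ) =
          1 / 2 * ∑ l : F,
            (torsionCount F n
              ((X - C (algebraMap F K l)) * (X ^ 2 - C (algebraMap F K b))) : ℚ)) ∧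
    (P.HasType K {3, 1} →
      ∀ α : K, α ^ Fintype.card F ^ 3 = α → α ∉ Set.range (algebraMap F K) →
        ((P.ponceletPairs K n).ncard : ℚ) =
          1 / 2 *
            ((∑ l : {l : F // l ≠ 0},
                (torsionCount F n (∏ i : Fin 3,
                  (X - C (α ^ Fintype.card F ^ (i : ℕ) /
                    (α ^ Fintype.card F ^ (i : ℕ) + algebraMap F K l)))) : ℚ)) +
              (torsionCount F n (∏ i : Fin 3,
                (X - C (α ^ Fintype.card F ^ (i : ℕ))⁻¹)) : ℚ) +
              (torsionCount F n (∏ i : Fin 3,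
                (X - C (α ^ Fintype.card F ^ (i : ℕ)))) : ℚ))) := by
  have h2 : (2 : K) ≠ 0 := Ring.two_ne_zero (Algebra.ringChar_eq F K ▸ hchar)
  refine ⟨fun h => ?_, fun h b hb => ?_, fun h α hα hαF => ?_⟩
  · obtain ⟨u, hu, hτ⟩ := h.elim
      (·.exists_isFrame h2 fun hσ => exists_actsOnSplittings_one (.inl hσ))
      (·.exists_isFrame h2 fun hσ => exists_actsOnSplittings_one (.inr hσ))
    simpa only [cubic_zero_one] using hu.ncard_ponceletPairs_of_one h2 hτ n
  · obtain ⟨u, hu, hτ⟩ := h.elim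
      (·.exists_isFrame h2 fun hσ => exists_actsOnSplittings_swap (.inl hσ))
      (·.exists_isFrame h2 fun hσ => exists_actsOnSplittings_swap (.inr hσ))
    obtain ⟨β, hβ⟩ := IsAlgClosed.exists_pow_nat_eq (algebraMap F K b) two_pos
    simpa only [cubic_neg, hβ] using hu.ncard_ponceletPairs_of_swap h2 hτ hb hβ n
  · obtain ⟨u, hu, hτ⟩ := h.exists_isFrame h2 exists_actsOnSplittings_finRotate
    exact hu.ncard_ponceletPairs_of_finRotate h2 hτ (pow_pow_eq_of_finRotate hα)
      (by simpa using hαF) n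

open Poncelet Polynomial in
theorem mainTheorem8 {F : Type*} [Field F] [Fintype F] [DecidableEq F]
    {K : Type*} [Field K] [DecidableEq K] [Algebra F K] [IsAlgClosure F K]
    (hchar : ringChar F ≠ 2) (n : ℕ) (hn : 1 ≤ n) (P : Pencil F) :
    -- types (1,1,1,1) and (2,2): the Legendre family
    ((P.HasType K {1, 1, 1, 1} ∨ P.HasType K {2, 2}) →
      ((P.ponceletPairs K n).ncard : ℚ) =
        1 / 2 * ∑ l : {l : F // l ≠ 0 ∧ l ≠ 1},
          (torsionCount F n (X * (X - 1) * (X - C (algebraMap F K l))) : ℚ)) ∧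
    -- types (2,1,1) and (4)
    ((P.HasType K {2, 1, 1} ∨ P.HasType K {4}) →
      ∀ b : F, ¬ IsSquare b →
        ((P.ponceletPairs K n).ncard : ℚ) =
          1 / 2 * ∑ l : F,
            (torsionCount F n
              ((X - C (algebraMap F K l)) * (X ^ 2 - C (algebraMap F K b))) : ℚ)) ∧
    -- type (3,1), with the conjugates of `α` being `α ^ q ^ i`; the last two terms are the members
    -- of the family at `0` and `∞`
    (P.HasType K {3, 1} →
      ∀ α : K, α ^ Fintype.card F ^ 3 = α → α ∉ Set.range (algebraMap F K) →
        ((P.ponceletPairs K n).ncard : ℚ) =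
          1 / 2 *
            ((∑ l : {l : F // l ≠ 0},
                (torsionCount F n (∏ i : Fin 3,
                  (X - C (α ^ Fintype.card F ^ (i : ℕ) /
                    (α ^ Fintype.card F ^ (i : ℕ) + algebraMap F K l)))) : ℚ)) +
              (torsionCount F n (∏ i : Fin 3,
                (X - C (α ^ Fintype.card F ^ (i : ℕ))⁻¹)) : ℚ) +
              (torsionCount F n (∏ i : Fin 3,
                (X - C (α ^ Fintype.card F ^ (i : ℕ)))) : ℚ))) := by
  have : IsAlgClosed K := IsAlgClosure.isAlgClosed F
  exact mainTheorem8_general hchar n P
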